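/- **Setting.** Fix a set $\mathsf P$ of proposition letters and a letter $p\notin\mathsf P$; the alphabets are $\wp(\mathsf P)$ and $\wp(\mathsf P\cup\{p\})$. For an alphabet $C$, a $C$-*tree* $\mathbb T=\langle T,R,\sigma,s_I\rangle$ (with $R\subseteq T\times T$, $\sigma:T\to C$) is such that every node is reachable from the root $s_I$, the root has no predecessor, every other node has exactly one predecessor, and $R[s]\neq\emptyset$ for every node $s$. *One-step logic.* For a set $A$, $\mathrm{FOE}_1^\infty(A)$ is the set of sentences of first-order logic with equality over the monadic predicates $a\in A$, extended with the quantifiers $\exists^\infty$ ("for infinitely many") and $\forall^\infty$ ("for all but finitely many"), interpreted in structures $(D,V)$ with $V:A\to\wp(D)$. A sentence is *positive* if all predicates occur under an even number of negations. A formula belongs to the fragment $\mathrm{Con}_a$ if it is generated by $\varphi::=\psi\mid a(x)\mid\exists x.\varphi\mid\varphi\wedge\varphi\mid\varphi\vee\varphi\mid\forall x.(\varphi\vee\psi)\wedge\forall^\infty x.\psi$, where $\psi$ ranges over formulas in which $a$ does not occur; it belongs to $\mathrm{Cocon}_a$ if its Boolean dual (exchange $\top/\bot$, $\wedge/\vee$,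 $\exists/\forall$, $\exists^\infty/\forall^\infty$, $\approx/\not\approx$) belongs to $\mathrm{Con}_a$. *Automata.* A parity automaton over $C$ is $\mathbb A=\langle A,\Delta,\Omega,a_I\rangle$ with $A$ finite, $a_I\in A$, $\Omega:A\to\mathbb N$, and $\Delta(a,c)$ a positive $\mathrm{FOE}_1^\infty(A)$-sentence for all $a\in A$, $c\in C$. In its acceptance game on $\mathbb T$, at $(a,s)\in A\times T$ player $\exists$ chooses $V:A\to\wp(R[s])$ with $(R[s],V)\models\Delta(a,\sigma(s))$, and then $\forall$ chooses $(b,t)$ with $t\in V(b)$. Position $(a,s)$ has priority $\Omega(a)$, position $V$ has priority $\max\Omega[A]$. A player who is stuck loses; $\exists$ wins an infinite match iff the least priority occurring infinitely often is even. $\mathbb A$ *accepts* $\mathbb T$ if $\exists$ has a (positional) winning strategy from $(a_I,s_I)$; $\mathcal T(\mathbb A)$ is the class of trees accepted by $\mathbb A$. Let $\preceq$ be the reflexive-transitive closure of the relation "$b$ occurs in $\Delta(a,c)$ for some $c$" between states $a,b$. $\mathbb A$ is a *WMSO-automaton* if for all $a,b\in A$ with $a\preceq b\preceq a$: $\Omega(a)=\Omega(b)$,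 and for every $c\in C$, $\Delta(a,c)\in\mathrm{Con}_b$ if $\Omega(a)$ is odd and $\Delta(a,c)\in\mathrm{Cocon}_b$ if $\Omega(a)$ is even. *Basic forms.* For a finite set $B$, $T_1,\dots,T_k\subseteq B$ and $\Pi,\Sigma\subseteq\wp(B)$, put $\tau_S^+(x)=\bigwedge_{b\in S}b(x)$, let $\mathrm{diff}$ say that its arguments are pairwise distinct, and let $$\nabla^+(\bar T,\Pi,\Sigma)=\exists\bar x.\Big(\mathrm{diff}(\bar x)\wedge\bigwedge_i\tau^+_{T_i}(x_i)\wedge\forall z.\big(\mathrm{diff}(\bar x,z)\to\!\!\bigvee_{S\in\Pi\cup\Sigma}\!\!\tau_S^+(z)\big)\Big)\wedge\bigwedge_{S\in\Sigma}\exists^\infty y.\tau_S^+(y)\wedge\forall^\infty y.\bigvee_{S\in\Sigma}\tau_S^+(y).$$ A sentence is in *basic form* if it is a finite disjunction of such sentences. *The construction.* Let $\mathbb A=\langle A,\Delta,\Omega,a_I\rangle$ be a WMSO-automaton over $\wp(\mathsf P\cup\{p\})$ and let $A^\sharp=\wp(A\times A)$ (considered disjoint from $A$); for $Q\in A^\sharp$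 let $\mathsf{Ran}(Q)$ be its range. For $Q\in A^\sharp$ and $c\subseteq\mathsf P\cup\{p\}$ let $\Psi_{Q,c}$ be a sentence in basic form over $A\times A$ equivalent to $\bigwedge_{a\in\mathsf{Ran}(Q)}\Delta(a,c)[b\mapsto(a,b)\mid b\in A]$. For $S\subseteq A\times A$ put $S^\uparrow=\{S\}\subseteq A^\sharp$ if $S\ne\emptyset$ and $\emptyset^\uparrow=\emptyset$, and put $\nabla^+(\bar T,\Pi,\Sigma)^F=\nabla^+\big((T_i^\uparrow)_i,\{S^\uparrow\mid S\in\Pi\cup\Sigma\},\{\mathsf{Ran}(S)\mid S\in\Sigma\}\big)$, a sentence over $A\cup A^\sharp$. Writing $\Psi_{Q,c}=\bigvee_i\varphi_i$, let $\Delta^F(a,c)=\Delta(a,c)$ for $a\in A$ and $\Delta^F(Q,c)=\bigvee_i\varphi_i^F\vee\bigwedge_{a\in\mathsf{Ran}(Q)}\Delta(a,c)$ for $Q\in A^\sharp$. The *finitary projection construct* $\exists_Fp.\mathbb A$ is the parity automaton over $\wp(\mathsf P)$ with states $A\cup A^\sharp$, initial state $\{(a_I,a_I)\}\in A^\sharp$,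 priorities $\Omega(a)$ for $a\in A$ and $1$ for $Q\in A^\sharp$, and transition map $a,c\mapsto\Delta^F(a,c)$ for $a\in A$, and $Q,c\mapsto\Delta^F(Q,c)\vee\Delta^F(Q,c\cup\{p\})$ for $Q\in A^\sharp$. For a class $L$ of $\wp(\mathsf P\cup\{p\})$-trees, $\exists_Fp.L$ is the class of $\wp(\mathsf P)$-trees $\mathbb T$ for which there is a finite set $S$ of nodes with $\mathbb T[p\mapsto S]\in L$, where $\mathbb T[p\mapsto S]$ is $\mathbb T$ with $p$ added to the labels of exactly the nodes in $S$. **Lemma.** For every WMSO-automaton $\mathbb A$ over $\wp(\mathsf P\cup\{p\})$, sentences $\Psi_{Q,c}$ as above exist, and for every choice of them $$\mathcal T(\exists_Fp.\mathbb A)=\exists_Fp.\mathcal T(\mathbb A).$$ That is, $\exists_Fp.\mathbb A$ accepts a tree $\mathbb T$ iff $\mathbb A$ accepts $\mathbb T[p\mapsto S]$ for some finite set $S$ of nodes. -/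

import Mathlib

universe u v w

noncomputable section

namespace WMSO

/-! ## The one-step language `FOE₁^∞(A)` -/

/-- Formulas of monadic first-order logic with equality and the quantifiers "there are infinitely
many" and "for all but finitely many", over the monadic predicates `A`, with free variables among
`x₀, …, x_{n-1}`. A quantifier binds the last variable of its body. Sentences are the formulas
with `n = 0`. -/
inductive OneStep (A : Type v) : ℕ → Type v
  | tru {n : ℕ} : OneStep A n
  | fls {n : ℕ} : OneStep A n
  | pred {n : ℕ} (a : A) (x : Fin n) : OneStep A n
  | eq {n : ℕ} (x y : Fin n) : OneStep A n
  | neg {n : ℕ} (φ : OneStep A n) : OneStep A n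
  | and {n : ℕ} (φ ψ : OneStep A n) : OneStep A n
  | or {n : ℕ} (φ ψ : OneStep A n) : OneStep A n
  | ex {n : ℕ} (φ : OneStep A (n + 1)) : OneStep A n
  | all {n : ℕ} (φ : OneStep A (n + 1)) : OneStep A n
  | exInf {n : ℕ} (φ : OneStep A (n + 1)) : OneStep A n
  | allInf {n : ℕ} (φ : OneStep A (n + 1)) : OneStep A n

abbrev Sentence (A : Type v) : Type v := OneStep A 0

namespace OneStep

/-- Truth of a formula in the structure `(D, V)` under the assignment `g`. -/
def Sat {A : Type v} {D : Type u} (V : A → Set D) : {n : ℕ} → OneStep A n → (Fin n → D) → Prop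
  | _, tru, _ => True
  | _, fls, _ => False
  | _, pred a x, g => g x ∈ V a
  | _, eq x y, g => g x = g y
  | _, neg φ, g => ¬ Sat V φ g
  | _, and φ ψ, g => Sat V φ g ∧ Sat V ψ g
  | _, or φ ψ, g => Sat V φ g ∨ Sat V ψ g
  | _, ex φ, g => ∃ d : D, Sat V φ (Fin.snoc (α := fun _ => D) g d)
  | _, all φ, g => ∀ d : D, Sat V φ (Fin.snoc (α := fun _ => D) g d)
  | _, exInf φ, g => {d : D | Sat V φ (Fin.snoc (α := fun _ => D) g d)}.Infinite
  | _, allInf φ, g => {d : D | ¬ Sat V φ (Fin.snoc (α := fun _ => D) g d)}.Finite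

/-- `(D, V) ⊨ φ` for a sentence `φ`. -/
def Holds {A : Type v} {D : Type u} (V : A → Set D) (φ : Sentence A) : Prop :=
  Sat V φ Fin.elim0

/-- Equivalence of sentences over all structures (with domain in universe `u`). -/
def Equivalent {A : Type v} (φ ψ : Sentence A) : Prop :=
  ∀ (D : Type u) (V : A → Set D), Holds V φ ↔ Holds V ψ

/-- The predicate `a` occurs in the formula. -/
def Occurs {A : Type v} (a : A) : {n : ℕ} → OneStep A n → Prop
  | _, tru => False
  | _, fls => False
  | _, pred b _ => b = a
  | _, eq _ _ => False
  | _, neg φ => Occurs a φ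
  | _, and φ ψ => Occurs a φ ∨ Occurs a ψ
  | _, or φ ψ => Occurs a φ ∨ Occurs a ψ
  | _, ex φ => Occurs a φ
  | _, all φ => Occurs a φ
  | _, exInf φ => Occurs a φ
  | _, allInf φ => Occurs a φ

/-- `Polarity true φ`: all predicates occur in `φ` under an even number of negations;
`Polarity false φ`: all predicates occur in `φ` under an odd number of negations. -/
def Polarity {A : Type v} : Bool → {n : ℕ} → OneStep A n → Prop
  | _, _, tru => True
  | _, _, fls => True
  | s, _, pred _ _ => s = true
  | _, _, eq _ _ => True
  | s, _, neg φ => Polarity (!s) φ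
  | s, _, and φ ψ => Polarity s φ ∧ Polarity s ψ
  | s, _, or φ ψ => Polarity s φ ∧ Polarity s ψ
  | s, _, ex φ => Polarity s φ
  | s, _, all φ => Polarity s φ
  | s, _, exInf φ => Polarity s φ
  | s, _, allInf φ => Polarity s φ

/-- Membership in the positive fragment. -/
def Positive {A : Type v} {n : ℕ} (φ : OneStep A n) : Prop := Polarity true φ

/-- Renaming of predicates along `f`. -/
def rename {A : Type v} {B : Type w} (f : A → B) : {n : ℕ} → OneStep A n → OneStep B n
  | _, tru => tru
  | _, fls => fls
  | _, pred a x => pred (f a) x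
  | _, eq x y => eq x y
  | _, neg φ => neg (rename f φ)
  | _, and φ ψ => and (rename f φ) (rename f ψ)
  | _, or φ ψ => or (rename f φ) (rename f ψ)
  | _, ex φ => ex (rename f φ)
  | _, all φ => all (rename f φ)
  | _, exInf φ => exInf (rename f φ)
  | _, allInf φ => allInf (rename f φ)

/-- The Boolean dual of a formula. -/
def dual {A : Type v} : {n : ℕ} → OneStep A n → OneStep A n
  | _, tru => fls
  | _, fls => tru
  | _, pred a x => pred a x
  | _, eq x y => neg (eq x y)
  | _, neg φ => neg (dual φ)
  | _, and φ ψ => or (dual φ) (dual ψ)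
  | _, or φ ψ => and (dual φ) (dual ψ)
  | _, ex φ => all (dual φ)
  | _, all φ => ex (dual φ)
  | _, exInf φ => allInf (dual φ)
  | _, allInf φ => exInf (dual φ)

/-- The syntactic fragment of formulas continuous in `a`:
`φ ::= ψ | a(x) | ∃x.φ | φ ∧ φ | φ ∨ φ | W x.(φ, ψ)` with `ψ` a formula in which `a` does not
occur, and `W x.(φ, ψ) := ∀x.(φ ∨ ψ) ∧ ∀^∞x.ψ`. -/
inductive Cont {A : Type v} (a : A) : {n : ℕ} → OneStep A n → Prop
  | free {n : ℕ} (ψ : OneStep A n) : ¬ Occurs a ψ → Cont a ψ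
  | pred {n : ℕ} (x : Fin n) : Cont a (OneStep.pred a x)
  | ex {n : ℕ} (φ : OneStep A (n + 1)) : Cont a φ → Cont a (OneStep.ex φ)
  | and {n : ℕ} (φ φ' : OneStep A n) : Cont a φ → Cont a φ' → Cont a (OneStep.and φ φ')
  | or {n : ℕ} (φ φ' : OneStep A n) : Cont a φ → Cont a φ' → Cont a (OneStep.or φ φ')
  | w {n : ℕ} (φ ψ : OneStep A (n + 1)) : Cont a φ → ¬ Occurs a ψ →
      Cont a (OneStep.and (OneStep.all (OneStep.or φ ψ)) (OneStep.allInf ψ))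

/-- The syntactic fragment of formulas co-continuous in `a`. -/
def Cocont {A : Type v} (a : A) {n : ℕ} (φ : OneStep A n) : Prop := Cont a (dual φ)

/-- Finite conjunction. -/
def conj {A : Type v} {n : ℕ} (l : List (OneStep A n)) : OneStep A n := l.foldr and tru

/-- Finite disjunction. -/
def disj {A : Type v} {n : ℕ} (l : List (OneStep A n)) : OneStep A n := l.foldr or fls

/-- The positive type `τ⁺_S(x) = ⋀_{a ∈ S} a(x)`. -/
def posType {A : Type v} {n : ℕ} (S : Finset A) (x : Fin n) : OneStep A n :=
  conj (S.toList.map fun a => pred a x)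

/-- `diff(x₀, …, x_{n-1})`: the elements are pairwise distinct. -/
def diff (A : Type v) (n : ℕ) : OneStep A n :=
  conj ((List.finRange n).flatMap fun i =>
    ((List.finRange n).filter fun j => i < j).map fun j => neg (eq i j))

/-- Existential closure. -/
def exs {A : Type v} : {n : ℕ} → OneStep A n → Sentence A
  | 0, φ => φ
  | _ + 1, φ => exs (ex φ)

/-! Positivity is preserved by the constructions used below. -/

theorem positive_conj {A : Type v} {n : ℕ} {l : List (OneStep A n)}
    (h : ∀ φ ∈ l, Positive φ) : Positive (conj l) := by
  induction l with
  | nil => exact trivial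
  | cons φ l ih =>
    exact ⟨h φ (by simp), ih fun ψ hψ => h ψ (by simp [hψ])⟩

theorem positive_disj {A : Type v} {n : ℕ} {l : List (OneStep A n)}
    (h : ∀ φ ∈ l, Positive φ) : Positive (disj l) := by
  induction l with
  | nil => exact trivial
  | cons φ l ih =>
    exact ⟨h φ (by simp), ih fun ψ hψ => h ψ (by simp [hψ])⟩

theorem positive_posType {A : Type v} {n : ℕ} (S : Finset A) (x : Fin n) :
    Positive (posType S x) := by
  refine positive_conj fun φ hφ => ?_
  obtain ⟨a, -, rfl⟩ := List.mem_map.1 hφ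
  exact rfl

theorem polarity_diff (A : Type v) (n : ℕ) (s : Bool) : Polarity s (diff A n) := by
  have key : ∀ l : List (OneStep A n), (∀ φ ∈ l, Polarity s φ) → Polarity s (conj l) := by
    intro l
    induction l with
    | nil => exact fun _ => trivial
    | cons φ l ih =>
      exact fun h => ⟨h φ (by simp), ih fun ψ hψ => h ψ (by simp [hψ])⟩
  refine key _ fun φ hφ => ?_
  obtain ⟨i, -, hi⟩ := List.mem_flatMap.1 hφ
  obtain ⟨j, -, rfl⟩ := List.mem_map.1 hi
  exact trivial

theorem positive_exs {A : Type v} {n : ℕ} {φ : OneStep A n} (h : Positive φ) :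
    Positive (exs φ) := by
  induction n with
  | zero => exact h
  | succ n ih => exact ih (φ := ex φ) h

theorem polarity_rename {A : Type v} {B : Type w} (f : A → B) {n : ℕ} (φ : OneStep A n) :
    ∀ s : Bool, Polarity s φ → Polarity s (rename f φ) := by
  induction φ with
  | tru | fls | eq => exact fun _ _ => trivial
  | pred a x => exact fun _ h => h
  | neg φ ih => exact fun s h => ih (!s) h
  | and φ ψ ih ih2 => exact fun s h => ⟨ih s h.1, ih2 s h.2⟩
  | or φ ψ ih ih2 => exact fun s h => ⟨ih s h.1, ih2 s h.2⟩
  | ex φ ih | all φ ih | exInf φ ih | allInf φ ih => exact fun s h => ih s h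

end OneStep

open OneStep

/-! ## Positive basic forms -/

/-- The data `(T₁, …, T_k; Π; Σ)` of a disjunct in basic form over the predicates `B`. -/
structure BasicForm (B : Type v) where
  k : ℕ
  T : Fin k → Finset B
  Pi : Finset (Finset B)
  Sig : Finset (Finset B)

namespace BasicForm

/-- `∃x̄.(diff(x̄) ∧ ⋀ᵢ τ⁺_{Tᵢ}(xᵢ) ∧ ∀z.(diff(x̄, z) → ⋁_{S ∈ Λ} τ⁺_S(z)))`. -/
def foePart {B : Type v} {k : ℕ} (T : Fin k → Finset B) (L : Finset (Finset B)) : Sentence B :=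
  exs ((diff B k).and ((conj ((List.finRange k).map fun i => posType (T i) i)).and
    (all ((neg (diff B (k + 1))).or
      (disj (L.toList.map fun S => posType S (Fin.last k)))))))

/-- `⋀_{S ∈ Σ} ∃^∞y.τ⁺_S(y) ∧ ∀^∞y.⋁_{S ∈ Σ} τ⁺_S(y)`. -/
def infPart {B : Type v} (Sig : Finset (Finset B)) : Sentence B :=
  (conj (Sig.toList.map fun S => exInf (posType S (Fin.last 0)))).and
    (allInf (disj (Sig.toList.map fun S => posType S (Fin.last 0))))

open Classical in
/-- The sentence `∇⁺(T̄, Π, Σ)`. -/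
def toSentence {B : Type v} (β : BasicForm B) : Sentence B :=
  (foePart β.T (β.Pi ∪ β.Sig)).and (infPart β.Sig)

theorem positive_toSentence {B : Type v} (β : BasicForm B) : Positive β.toSentence := by
  have hd : ∀ {n : ℕ} (L : Finset (Finset B)) (x : Fin n),
      Positive (disj (L.toList.map fun S => posType S x)) := fun L x =>
    positive_disj fun φ hφ => by
      obtain ⟨S, -, rfl⟩ := List.mem_map.1 hφ
      exact positive_posType S x
  refine ⟨positive_exs ⟨polarity_diff _ _ _, positive_conj fun φ hφ => ?_,
    polarity_diff _ _ _, hd _ _⟩, positive_conj fun φ hφ => ?_, hd _ _⟩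
  · obtain ⟨i, -, rfl⟩ := List.mem_map.1 hφ
    exact positive_posType _ _
  · obtain ⟨S, -, rfl⟩ := List.mem_map.1 hφ
    exact positive_posType S _

end BasicForm

/-- `⋁ᵢ ∇⁺(T̄ᵢ, Πᵢ, Σᵢ)`. -/
def basicDisj {B : Type v} (l : List (BasicForm B)) : Sentence B :=
  disj (l.map BasicForm.toSentence)

/-! ## Macro-states and the finitary lifting -/

/-- `A^♯ = ℘(A × A)`; for finite `A` all binary relations on `A` are finite sets of pairs. -/
abbrev Macro (A : Type v) : Type v := Finset (A × A)

open Classical in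
/-- The range of a binary relation. -/
def ran {A : Type v} (Q : Macro A) : Finset A := Q.image Prod.snd

/-- The lifting of one type `S ⊆ A × A`, as a type over `A ∪ A^♯`:
`{S}` if `S` is non-empty, and the empty type otherwise. -/
def liftType {A : Type v} (S : Finset (A × A)) : Finset (A ⊕ Macro A) :=
  open Classical in if S = ∅ then ∅ else {Sum.inr S}

open Classical in
/-- The lifting of a set of types, elementwise. -/
def liftTypes {A : Type v} (L : Finset (Finset (A × A))) : Finset (Finset (A ⊕ Macro A)) :=
  L.image liftType

open Classical in
/-- The set of `A`-types `{Ran(S) | S ∈ Σ}`, as types over `A ∪ A^♯`. -/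
def ranTypes {A : Type v} (L : Finset (Finset (A × A))) : Finset (Finset (A ⊕ Macro A)) :=
  L.image fun S => (ran S).image Sum.inl

open Classical in
/-- The finitary lifting `(T̄, Π, Σ) ↦ (T̄↑, Π↑ ∪ Σ↑, {Ran(S) | S ∈ Σ})`. -/
def BasicForm.finLift {A : Type v} (β : BasicForm (A × A)) : BasicForm (A ⊕ Macro A) where
  k := β.k
  T := fun i => liftType (β.T i)
  Pi := liftTypes β.Pi ∪ liftTypes β.Sig
  Sig := ranTypes β.Sig

/-! ## Transition systems, trees, parity games -/

/-- Labelled transition systems over the alphabet `C`. -/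
structure LTS (C : Type w) where
  Node : Type u
  R : Node → Node → Prop
  label : Node → C
  root : Node

/-- Leafless trees. -/
structure Tree (C : Type w) extends LTS.{u, w} C where
  reachable : ∀ s, Relation.ReflTransGen R root s
  root_no_pred : ∀ s, ¬ R s root
  unique_pred : ∀ s, s ≠ root → ∃! t, R t s
  leafless : ∀ s, ∃ t, R s t

abbrev TreeLanguage (C : Type w) := Set (Tree.{u, w} C)

/-- Parity games with players `∃` and `∀`; `∀` owns the positions that `∃` does not own. -/
structure ParityGame where
  Pos : Type u
  exPos : Set Pos
  Move : Pos → Pos → Prop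
  Ω : Pos → ℕ

namespace ParityGame

/-- The winning condition for `∃` on infinite matches: the least priority that occurs infinitely
often is even. -/
def ParityWin (G : ParityGame.{u}) (π : ℕ → G.Pos) : Prop :=
  ∃ n : ℕ, Even n ∧ (∃ᶠ i in Filter.atTop, G.Ω (π i) = n) ∧
    ∀ m < n, ¬ ∃ᶠ i in Filter.atTop, G.Ω (π i) = m

/-- The step from `x` to `y` is a move of the game, and follows the positional strategy `f` of `∃`
if `x` is one of her positions. -/
def GuidedStep (G : ParityGame.{u}) (f : G.Pos → G.Pos) (x y : G.Pos) : Prop :=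
  G.Move x y ∧ (x ∈ G.exPos → y = f x)

/-- The positional strategy `f` is winning for `∃` from `x`: at the end of every finite `f`-guided
match `π₀ … π_k` from `x` in which she is to move, `f` prescribes an admissible move (so that
she never gets stuck, and wins every finite total match), and she wins every infinite `f`-guided
match from `x`. -/
def Winning (G : ParityGame.{u}) (x : G.Pos) (f : G.Pos → G.Pos) : Prop :=
  (∀ (k : ℕ) (π : ℕ → G.Pos), π 0 = x → (∀ i < k, G.GuidedStep f (π i) (π (i + 1))) →
    π k ∈ G.exPos → G.Move (π k) (f (π k))) ∧
  ∀ π : ℕ → G.Pos, π 0 = x → (∀ i, G.GuidedStep f (π i) (π (i + 1))) → G.ParityWin π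

end ParityGame

/-! ## Parity automata -/

/-- Parity automata over the alphabet `C`, based on the one-step language `FOE₁^∞`. -/
structure ParityAutomaton (C : Type w) where
  State : Type v
  finite : Finite State
  Δ : State → C → Sentence State
  positive : ∀ a c, Positive (Δ a c)
  Ω : State → ℕ
  init : State

/-- Positions of the acceptance game: basic positions `(a, s)` and valuations `V : A → ℘(T)`. -/
inductive GamePos (A : Type v) (T : Type u) : Type (max u v)
  | basic (a : A) (s : T) : GamePos A T
  | val (V : A → Set T) : GamePos A T

namespace ParityAutomaton

/-- The admissible moves of the acceptance game. -/
def GameMove {C : Type w} (𝔸 : ParityAutomaton.{v, w} C) (𝕋 : LTS.{u, w} C) :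
    GamePos 𝔸.State 𝕋.Node → GamePos 𝔸.State 𝕋.Node → Prop
  | .basic a s, .val V => (∀ b, V b ⊆ {t | 𝕋.R s t}) ∧
      Holds (D := {t : 𝕋.Node // 𝕋.R s t}) (fun b => {t | t.1 ∈ V b}) (𝔸.Δ a (𝕋.label s))
  | .val V, .basic b t => t ∈ V b
  | _, _ => False

/-- The priorities of the acceptance game. -/
def GamePriority {C : Type w} (𝔸 : ParityAutomaton.{v, w} C) {T : Type u} :
    GamePos 𝔸.State T → ℕ
  | .basic a _ => 𝔸.Ω a
  | .val _ => ⨆ a, 𝔸.Ω a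

/-- The acceptance game of an automaton on a transition system. -/
def game {C : Type w} (𝔸 : ParityAutomaton.{v, w} C) (𝕋 : LTS.{u, w} C) : ParityGame where
  Pos := GamePos 𝔸.State 𝕋.Node
  exPos := {x | ∃ a s, x = .basic a s}
  Move := 𝔸.GameMove 𝕋
  Ω := 𝔸.GamePriority

/-- `∃` has a winning strategy from the initial position of the acceptance game. -/
def Accepts {C : Type w} (𝔸 : ParityAutomaton.{v, w} C) (𝕋 : LTS.{u, w} C) : Prop :=
  ∃ f, (𝔸.game 𝕋).Winning (.basic 𝔸.init 𝕋.root) f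

/-- The tree language recognized by an automaton. -/
def language {C : Type w} (𝔸 : ParityAutomaton.{v, w} C) : TreeLanguage.{u, w} C :=
  {𝕋 | 𝔸.Accepts 𝕋.toLTS}

/-- The reachability relation: reflexive-transitive closure of
"`b` occurs in `Δ(a, c)` for some `c`". -/
def Reach {C : Type w} (𝔸 : ParityAutomaton.{v, w} C) : 𝔸.State → 𝔸.State → Prop :=
  Relation.ReflTransGen fun a b => ∃ c, Occurs b (𝔸.Δ a c)

/-- `WMSO`-automata: parity automata satisfying weakness and continuity. -/
def IsWMSO {C : Type w} (𝔸 : ParityAutomaton.{v, w} C) : Prop :=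
  ∀ a b : 𝔸.State, 𝔸.Reach a b → 𝔸.Reach b a →
    𝔸.Ω a = 𝔸.Ω b ∧
    (Odd (𝔸.Ω a) → ∀ c, Cont b (𝔸.Δ a c)) ∧
    (Even (𝔸.Ω a) → ∀ c, Cocont b (𝔸.Δ a c))

/-! ## The finitary construct and the finitary projection construct -/

/-- `⋀_{a ∈ Ran(Q)} Δ⋆(a, c)`, where `Δ⋆(a, c) = Δ(a, c)[b ↦ (a, b) | b ∈ A]`. -/
def starConj {C : Type w} (𝔸 : ParityAutomaton.{v, w} C) (Q : Macro 𝔸.State) (c : C) :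
    Sentence (𝔸.State × 𝔸.State) :=
  conj ((ran Q).toList.map fun a => (𝔸.Δ a c).rename fun b => (a, b))

/-- A choice, for every macro-state `Q` and letter `c`, of the disjuncts of a sentence `Ψ_{Q,c}`
in positive basic form that is equivalent to `⋀_{a ∈ Ran(Q)} Δ⋆(a, c)`. -/
def IsBasicChoice {C : Type w} (𝔸 : ParityAutomaton.{v, w} C)
    (Ψ : Macro 𝔸.State → C → List (BasicForm (𝔸.State × 𝔸.State))) : Prop :=
  ∀ Q c, Equivalent.{u} (basicDisj (Ψ Q c)) (𝔸.starConj Q c)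

/-- The finitary construct `𝔸^F` over `𝔸`, built from the basic forms `Ψ`:
`Δ^F(a, c) = Δ(a, c)`, `Δ^F(R, c) = ⋁ᵢ φᵢ^F ∨ ⋀_{a ∈ Ran(R)} Δ(a, c)` with `Ψ_{R,c} = ⋁ᵢ φᵢ`. -/
def finitary {C : Type w} (𝔸 : ParityAutomaton.{v, w} C)
    (Ψ : Macro 𝔸.State → C → List (BasicForm (𝔸.State × 𝔸.State))) :
    ParityAutomaton.{v, w} C where
  State := 𝔸.State ⊕ Macro 𝔸.State
  finite := by
    have := 𝔸.finite
    infer_instance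
  Δ
    | .inl a, c => (𝔸.Δ a c).rename Sum.inl
    | .inr R, c => (basicDisj ((Ψ R c).map BasicForm.finLift)).or
        (conj ((ran R).toList.map fun a => (𝔸.Δ a c).rename Sum.inl))
  positive
    | .inl a, c => polarity_rename _ _ _ (𝔸.positive a c)
    | .inr R, c => ⟨positive_disj fun φ hφ => by
        obtain ⟨β, -, rfl⟩ := List.mem_map.1 hφ
        exact β.positive_toSentence, positive_conj fun φ hφ => by
        obtain ⟨a, -, rfl⟩ := List.mem_map.1 hφ
        exact polarity_rename _ _ _ (𝔸.positive a c)⟩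
  Ω
    | .inl a => 𝔸.Ω a
    | .inr _ => 1
  init := .inr {(𝔸.init, 𝔸.init)}

/-- The finitary projection construct `∃_F p.𝔸`. The letters `P ∪ {p}`, with `p ∉ P`, are
`Option P`, with `p = none`. -/
def finProj {P : Type w} (𝔸 : ParityAutomaton.{v, w} (Set (Option P)))
    (Ψ : Macro 𝔸.State → Set (Option P) → List (BasicForm (𝔸.State × 𝔸.State))) :
    ParityAutomaton.{v, w} (Set P) where
  State := 𝔸.State ⊕ Macro 𝔸.State
  finite := (𝔸.finitary Ψ).finite
  Δ
    | .inl a, c => (𝔸.finitary Ψ).Δ (.inl a) (some '' c)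
    | .inr R, c => ((𝔸.finitary Ψ).Δ (.inr R) (some '' c)).or
        ((𝔸.finitary Ψ).Δ (.inr R) (some '' c ∪ {none}))
  positive
    | .inl a, c => (𝔸.finitary Ψ).positive (.inl a) (some '' c)
    | .inr R, c => ⟨(𝔸.finitary Ψ).positive (.inr R) (some '' c),
        (𝔸.finitary Ψ).positive (.inr R) (some '' c ∪ {none})⟩
  Ω := (𝔸.finitary Ψ).Ω
  init := (𝔸.finitary Ψ).init

end ParityAutomaton

/-! ## Finite projection of a tree language -/

/-- The `p`-variant `𝕋[p ↦ S]`. -/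
def Tree.variant {P : Type w} (𝕋 : Tree.{u, w} (Set P)) (S : Set 𝕋.Node) :
    Tree.{u, w} (Set (Option P)) where
  Node := 𝕋.Node
  R := 𝕋.R
  label := fun s => some '' 𝕋.label s ∪ {l | l = none ∧ s ∈ S}
  root := 𝕋.root
  reachable := 𝕋.reachable
  root_no_pred := 𝕋.root_no_pred
  unique_pred := 𝕋.unique_pred
  leafless := 𝕋.leafless

/-- The finite projection `∃_F p.L` of a tree language `L`. -/
def TreeLanguage.finProj {P : Type w} (L : TreeLanguage.{u, w} (Set (Option P))) :
    TreeLanguage.{u, w} (Set P) :=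
  {𝕋 | ∃ S : Set 𝕋.Node, S.Finite ∧ 𝕋.variant S ∈ L}

end WMSO

end

/-!
The equivalence between `∃_F p.𝔸` and the finite projection of `𝔸` rests on choosing the witnesses of
basic forms functionally.

*Basic forms exist.* A sentence of quantifier rank `K` cannot distinguish two monadic structures in
which every type is realized equally often up to `K`, and the same types are realized infinitely
often (`holds_iff_of_countEquiv`). Over finitely many predicates there are finitely many such
profiles, and each is described by a basic form. A model of the positive basic form of a profile
can be shrunk to a structure with exactly that profile, so positivity makes a sentence equivalent to
the disjunction over the profiles of its models (`exists_basicDisj_equivalent`).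

*One step.* The lemma `exists_type_assignment` turns a model of `∇⁺(T̄, Π, Σ)` into an assignment of a
single type to each point, such that all but finitely many points get a type in `Σ`. For the
lifted form `∇⁺(T̄, Π, Σ)^F` this means that only finitely many points are marked by macro-states, and
by one macro-state each; the range `Ran(S)` of their types suffices for all other points.

*From `∃_F p.𝔸` to `𝔸`.* In a winning strategy for `∃_F p.𝔸` with such functional choices, the nodes
visited in macro-states form a finitely branching subtree. Macro-states have priority `1`, so it has
no infinite branch, and it is finite by Kőnig's lemma. The set `S` consists of its nodes at which
the letter `p` is guessed (`exists_finite_variant_accepts`).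

*From `𝔸` to `∃_F p.𝔸`.* Given a finite set `S`, the strategy for `𝔸` is bundled into macro-states on
the finite set of ancestors of `S`, and dismantled when the match leaves this set
(`finProj_accepts_of_variant`).

Both translations act on positional strategies, in the form of `ParityAutomaton.IsStrategy`, which
only mentions positions `(a, s)`.
-/

namespace WMSO

/-! ### Semantics of formulas and basic forms -/

namespace OneStep

theorem sat_conj {A : Type v} {D : Type u} (V : A → Set D) {n : ℕ} (l : List (OneStep A n))
    (g : Fin n → D) : Sat V (conj l) g ↔ ∀ φ ∈ l, Sat V φ g := by
  induction l with
  | nil => simp [conj, Sat]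
  | cons φ l ih =>
    have : Sat V (conj (φ :: l)) g ↔ Sat V φ g ∧ Sat V (conj l) g := Iff.rfl
    rw [this, ih, List.forall_mem_cons]

theorem sat_disj {A : Type v} {D : Type u} (V : A → Set D) {n : ℕ} (l : List (OneStep A n))
    (g : Fin n → D) : Sat V (disj l) g ↔ ∃ φ ∈ l, Sat V φ g := by
  induction l with
  | nil => simp [disj, Sat]
  | cons φ l ih =>
    have : Sat V (disj (φ :: l)) g ↔ Sat V φ g ∨ Sat V (disj l) g := Iff.rfl
    rw [this, ih, List.exists_mem_cons_iff]

theorem sat_rename {A : Type v} {B : Type w} {D : Type u} (f : A → B) (V : B → Set D) {n : ℕ}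
    (φ : OneStep A n) (g : Fin n → D) :
    Sat V (rename f φ) g ↔ Sat (fun a => V (f a)) φ g := by
  induction φ with
  | tru | fls | pred | eq => exact Iff.rfl
  | neg φ ih => exact not_congr (ih g)
  | and φ ψ ih ih' => exact and_congr (ih g) (ih' g)
  | or φ ψ ih ih' => exact or_congr (ih g) (ih' g)
  | ex φ ih => exact exists_congr fun d => ih _
  | all φ ih => exact forall_congr' fun d => ih _
  | exInf φ ih => simp only [rename, Sat, ih]
  | allInf φ ih => simp only [rename, Sat, ih]

theorem sat_mono_of_polarity {A : Type v} {D : Type u} {V V' : A → Set D}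
    (hV : ∀ a, V a ⊆ V' a) {n : ℕ} (φ : OneStep A n) :
    ∀ g : Fin n → D, (Polarity true φ → Sat V φ g → Sat V' φ g) ∧
      (Polarity false φ → Sat V' φ g → Sat V φ g) := by
  induction φ with
  | tru | fls | eq => exact fun g => ⟨fun _ h => h, fun _ h => h⟩
  | pred a x => exact fun g => ⟨fun _ h => hV a h, fun h => by cases h⟩
  | neg φ ih =>
    exact fun g => ⟨fun hp h h' => h ((ih g).2 hp h'), fun hp h h' => h ((ih g).1 hp h')⟩
  | and φ ψ ih ih' =>
    exact fun g => ⟨fun hp h => ⟨(ih g).1 hp.1 h.1, (ih' g).1 hp.2 h.2⟩,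
      fun hp h => ⟨(ih g).2 hp.1 h.1, (ih' g).2 hp.2 h.2⟩⟩
  | or φ ψ ih ih' =>
    exact fun g => ⟨fun hp h => h.imp ((ih g).1 hp.1) ((ih' g).1 hp.2),
      fun hp h => h.imp ((ih g).2 hp.1) ((ih' g).2 hp.2)⟩
  | ex φ ih =>
    exact fun g => ⟨fun hp h => h.imp fun d => (ih _).1 hp, fun hp h => h.imp fun d => (ih _).2 hp⟩
  | all φ ih =>
    exact fun g => ⟨fun hp h d => (ih _).1 hp (h d), fun hp h d => (ih _).2 hp (h d)⟩
  | exInf φ ih =>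
    exact fun g => ⟨fun hp h => h.mono fun d => (ih _).1 hp, fun hp h => h.mono fun d => (ih _).2 hp⟩
  | allInf φ ih =>
    exact fun g => ⟨fun hp h => h.subset fun d => mt ((ih _).1 hp),
      fun hp h => h.subset fun d => mt ((ih _).2 hp)⟩

theorem Positive.holds_mono {A : Type v} {D : Type u} {V V' : A → Set D} {φ : Sentence A}
    (hφ : Positive φ) (hV : ∀ a, V a ⊆ V' a) (h : Holds V φ) : Holds V' φ :=
  (sat_mono_of_polarity hV φ _).1 hφ h

theorem holds_exs {A : Type v} {D : Type u} (V : A → Set D) {n : ℕ} (φ : OneStep A n) :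
    Holds V (exs φ) ↔ ∃ g : Fin n → D, Sat V φ g := by
  induction n with
  | zero =>
    exact ⟨fun h => ⟨_, h⟩, fun ⟨g, h⟩ => by rwa [Subsingleton.elim g Fin.elim0] at h⟩
  | succ n ih =>
    refine (ih (ex φ)).trans ⟨fun ⟨g, d, h⟩ => ⟨_, h⟩,
      fun ⟨g, h⟩ => ⟨Fin.init g, g (Fin.last n), ?_⟩⟩
    rwa [Fin.snoc_init_self]

theorem sat_diff {A : Type v} {D : Type u} (V : A → Set D) {n : ℕ} (g : Fin n → D) :
    Sat V (diff A n) g ↔ Function.Injective g := by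
  have : Sat V (diff A n) g ↔ ∀ i j, i < j → g i ≠ g j := by
    simp only [diff, sat_conj, List.mem_flatMap, List.mem_map, List.mem_filter,
      List.mem_finRange, true_and, decide_eq_true_eq]
    constructor
    · exact fun h i j hij => h _ ⟨i, j, hij, rfl⟩
    · rintro h _ ⟨i, j, hij, rfl⟩
      exact h i j hij
  rw [this]
  refine ⟨fun h i j hij => ?_, fun h i j hij e => hij.ne (h e)⟩
  rcases lt_trichotomy i j with hlt | he | hlt
  exacts [(h i j hlt hij).elim, he, (h j i hlt hij.symm).elim]

theorem sat_posType {A : Type v} {D : Type u} (V : A → Set D) {n : ℕ} (S : Finset A) (x : Fin n)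
    (g : Fin n → D) : Sat V (posType S x) g ↔ ∀ a ∈ S, g x ∈ V a := by
  simp [posType, sat_conj, Sat]

theorem sat_disj_posType {A : Type v} {D : Type u} (V : A → Set D) {n : ℕ}
    (L : Finset (Finset A)) (x : Fin n) (g : Fin n → D) :
    Sat V (disj (L.toList.map fun S => posType S x)) g ↔ ∃ S ∈ L, ∀ a ∈ S, g x ∈ V a := by
  simp [sat_disj, sat_posType]

end OneStep

open OneStep

theorem BasicForm.holds_toSentence {B : Type v} {D : Type u} (V : B → Set D) (β : BasicForm B) :
    Holds V β.toSentence ↔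
      (∃ x : Fin β.k → D, Function.Injective x ∧ (∀ i, ∀ b ∈ β.T i, x i ∈ V b) ∧
        ∀ z ∉ Set.range x, ∃ S, (S ∈ β.Pi ∨ S ∈ β.Sig) ∧ ∀ b ∈ S, z ∈ V b) ∧
      (∀ S ∈ β.Sig, {y | ∀ b ∈ S, y ∈ V b}.Infinite) ∧
      {y | ¬ ∃ S ∈ β.Sig, ∀ b ∈ S, y ∈ V b}.Finite := by
  refine and_congr ?_ (and_congr ?_ ?_)
  · refine (holds_exs V _).trans (exists_congr fun x => ?_)
    trans Function.Injective x ∧ (∀ i, ∀ b ∈ β.T i, x i ∈ V b) ∧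
        ∀ z, ¬ Function.Injective (Fin.snoc (α := fun _ => D) x z) ∨
          ∃ S, (S ∈ β.Pi ∨ S ∈ β.Sig) ∧ ∀ b ∈ S, z ∈ V b
    · refine and_congr (sat_diff V x) (and_congr ?_ (forall_congr' fun z => ?_))
      · simp [sat_conj, sat_posType]
      · refine or_congr (not_congr (sat_diff V _)) ((sat_disj_posType V _ _ _).trans ?_)
        simp only [Fin.snoc_last, Finset.mem_union]
    · refine and_congr_right fun hx => and_congr_right fun _ => forall_congr' fun z => ?_
      rw [Fin.snoc_injective_iff]
      simp [hx, or_iff_not_imp_left]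
  · refine (sat_conj V _ _).trans ?_
    simp only [List.mem_map, Finset.mem_toList, forall_exists_index, and_imp,
      forall_apply_eq_imp_iff₂]
    refine forall₂_congr fun S _ => ?_
    simp only [Sat, sat_posType, Fin.snoc_last]
  · change Set.Finite _ ↔ _
    simp only [sat_disj_posType, Fin.snoc_last]

theorem holds_basicDisj {B : Type v} {D : Type u} (V : B → Set D) (l : List (BasicForm B)) :
    Holds V (basicDisj l) ↔ ∃ β ∈ l, Holds V β.toSentence := by
  simp [basicDisj, Holds, sat_disj]

/-! ### Distributing types over a domain -/

/-- Infinite sets have a system of distinct representatives. -/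
theorem exists_injective_forall_mem {D : Type u} {E : ℕ → Set D} (hE : ∀ n, (E n).Infinite) :
    ∃ f : ℕ → D, Function.Injective f ∧ ∀ n, f n ∈ E n := by
  classical
  have hne : ∀ n (s : Finset D), ∃ d ∈ E n, d ∉ s := fun n s => (hE n).exists_notMem_finset s
  choose c hc hc' using hne
  let F : ℕ → Finset D := fun n => Nat.rec ∅ (fun n s => insert (c n s) s) n
  have hF : ∀ n, F (n + 1) = insert (c n (F n)) (F n) := fun n => rfl
  have hmono : Monotone F := monotone_nat_of_le_succ fun n => by
    rw [hF]; exact Finset.subset_insert _ _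
  refine ⟨fun n => c n (F n), Function.Injective.of_lt_imp_ne fun i j hij e => ?_, fun n => hc _ _⟩
  refine hc' j (F j) (hmono hij ?_)
  rw [← e, hF]
  exact Finset.mem_insert_self _ _

/-- Finitely many infinite sets contain pairwise disjoint infinite subsets, given here as the fibres
of a partial colouring `c`. -/
theorem exists_disjoint_infinite {D : Type u} {ι : Type w} (Sig : Finset ι) {E : ι → Set D}
    (hE : ∀ S ∈ Sig, (E S).Infinite) :
    ∃ c : D → Option ι, (∀ z S, c z = some S → S ∈ Sig ∧ z ∈ E S) ∧
      ∀ S ∈ Sig, {z | c z = some S}.Infinite := by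
  classical
  rcases Sig.eq_empty_or_nonempty with rfl | hne
  · exact ⟨fun _ => none, by simp, by simp⟩
  have : Nonempty Sig := hne.to_subtype
  obtain ⟨e, he⟩ := exists_surjective_nat (Sig × ℕ)
  obtain ⟨f, hf, hfE⟩ := exists_injective_forall_mem (E := fun n => E (e n).1)
    fun n => hE _ (e n).1.2
  refine ⟨fun z => if h : ∃ n, f n = z then some (e h.choose).1 else none, ?_, ?_⟩
  · intro z S hz
    dsimp only at hz
    split_ifs at hz with h
    obtain rfl := Option.some.inj hz
    refine ⟨(e h.choose).1.2, ?_⟩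
    have := hfE h.choose
    rwa [h.choose_spec] at this
  · intro S hS
    have hinf : {n | (e n).1 = ⟨S, hS⟩}.Infinite := by
      refine Set.Infinite.of_image e (Set.Infinite.mono ?_
        (Set.infinite_range_of_injective (f := fun k : ℕ => ((⟨S, hS⟩ : Sig), k)) ?_))
      · rintro _ ⟨k, rfl⟩
        obtain ⟨n, hn⟩ := he (⟨S, hS⟩, k)
        exact ⟨n, by simp [hn], hn⟩
      · exact fun i j h => (Prod.ext_iff.1 h).2
    refine (hinf.image hf.injOn).mono ?_
    rintro _ ⟨n, hn, rfl⟩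
    have h : ∃ m, f m = f n := ⟨n, rfl⟩
    have h2 : h.choose = n := hf h.choose_spec
    simp only [Set.mem_ofPred_eq] at hn ⊢
    rw [dif_pos h, h2, hn]

/-- Witnesses for a formula of the shape `∇⁺(T̄, Π, Σ)` can be chosen functionally: every point gets
one type `G z`. On a finite set `M`, which contains the points `x̄` and a prescribed finite set `X`,
types are realized in the sense of `q`; outside `M` they belong to `Σ` and are realized in the sense
of `p`, and each type of `Σ` is used infinitely often there. -/
theorem exists_type_assignment {D : Type u} {ι : Type w} {k : ℕ} {T : Fin k → ι}
    {L : Set ι} {Sig : Finset ι} {p q : ι → D → Prop} {x : Fin k → D} {X : Set D} (hX : X.Finite)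
    (hL : ↑Sig ⊆ L) (hx : Function.Injective x) (hT : ∀ i, q (T i) (x i))
    (hq : ∀ z ∉ Set.range x, (¬ ∃ S ∈ Sig, p S z) ∨ z ∈ X → ∃ S ∈ L, q S z)
    (hinf : ∀ S ∈ Sig, {y | p S y}.Infinite) (hfin : {y | ¬ ∃ S ∈ Sig, p S y}.Finite) :
    ∃ (G : D → ι) (M : Set D), M.Finite ∧ X ⊆ M ∧ Set.range x ⊆ M ∧ (∀ i, G (x i) = T i) ∧
      (∀ z ∉ Set.range x, G z ∈ L) ∧ (∀ z ∉ M, G z ∈ Sig ∧ p (G z) z) ∧ (∀ z ∈ M, q (G z) z) ∧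
      ∀ S ∈ Sig, {z | z ∉ M ∧ G z = S}.Infinite := by
  set M : Set D := Set.range x ∪ X ∪ {y | ¬ ∃ S ∈ Sig, p S y}
  have hMfin : M.Finite := ((Set.finite_range x).union hX).union hfin
  obtain ⟨c, hc, hc'⟩ := exists_disjoint_infinite Sig (E := fun S => {y | p S y} \ M)
    fun S hS => (hinf S hS).sdiff hMfin
  have key : ∀ z, ∃ S, (∀ i, x i = z → S = T i) ∧ (z ∉ Set.range x → S ∈ L) ∧
      (z ∉ M → S ∈ Sig ∧ p S z) ∧ (z ∈ M → q S z) ∧ ∀ S', c z = some S' → S = S' := by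
    intro z
    by_cases hz : z ∈ M
    · have hcz : ∀ S', c z ≠ some S' := fun S' h => (hc z S' h).2.2 hz
      by_cases hr : z ∈ Set.range x
      · obtain ⟨i, rfl⟩ := hr
        exact ⟨T i, fun j hj => by rw [hx hj], fun h => (h ⟨i, rfl⟩).elim,
          fun h => (h hz).elim, fun _ => hT i, fun S' h => (hcz S' h).elim⟩
      · obtain ⟨S, hS, hS'⟩ := hq z hr (by
          rcases hz with (h | h) | h
          exacts [(hr h).elim, Or.inr h, Or.inl h])
        exact ⟨S, fun i hi => (hr ⟨i, hi⟩).elim, fun _ => hS, fun h => (h hz).elim,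
          fun _ => hS', fun S' h => (hcz S' h).elim⟩
    · have hr : z ∉ Set.range x := fun h => hz (Or.inl (Or.inl h))
      have hp : ∃ S ∈ Sig, p S z := by
        by_contra h
        exact hz (Or.inr h)
      obtain ⟨S, hS, hS', hcS⟩ : ∃ S ∈ Sig, p S z ∧ ∀ S', c z = some S' → S = S' := by
        rcases h : c z with _ | S
        · obtain ⟨S, hS, hS'⟩ := hp
          exact ⟨S, hS, hS', by simp⟩
        · exact ⟨S, (hc z S h).1, (hc z S h).2.1, by simp⟩
      exact ⟨S, fun i hi => (hr ⟨i, hi⟩).elim, fun _ => hL hS, fun _ => ⟨hS, hS'⟩,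
        fun h => (hz h).elim, hcS⟩
  choose G hG1 hG2 hG3 hG4 hG5 using key
  refine ⟨G, M, hMfin, fun z h => Or.inl (Or.inr h), fun z h => Or.inl (Or.inl h),
    fun i => hG1 _ i rfl, hG2, hG3, hG4, fun S hS => (hc' S hS).mono fun z h => ?_⟩
  exact ⟨(hc z S h).2.2, hG5 z S h⟩

/-! ### Ehrenfeucht–Fraïssé invariance of the one-step language -/

namespace OneStep

/-- Quantifier rank. -/
def rank {A : Type v} : {n : ℕ} → OneStep A n → ℕ
  | _, tru => 0
  | _, fls => 0
  | _, pred _ _ => 0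
  | _, eq _ _ => 0
  | _, neg φ => rank φ
  | _, and φ ψ => max (rank φ) (rank ψ)
  | _, or φ ψ => max (rank φ) (rank ψ)
  | _, ex φ => rank φ + 1
  | _, all φ => rank φ + 1
  | _, exInf φ => rank φ + 1
  | _, allInf φ => rank φ + 1

end OneStep

/-- Two domains whose points are coloured by `f` and `f'` have, for every colour, the same number of
points up to the threshold `K`, and agree on which colours occur infinitely often. -/
structure CountEquiv {τ : Type w} {D D' : Type u} (K : ℕ) (f : D → τ) (f' : D' → τ) : Prop where
  card : ∀ S, ∀ j ≤ K, (j : ℕ∞) ≤ (f ⁻¹' {S}).encard ↔ (j : ℕ∞) ≤ (f' ⁻¹' {S}).encard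
  infinite : ∀ S, (f ⁻¹' {S}).Infinite ↔ (f' ⁻¹' {S}).Infinite

/-- Two tuples have the same colours and satisfy the same equalities. -/
structure PartialIso {τ : Type w} {D D' : Type u} (f : D → τ) (f' : D' → τ) {n : ℕ}
    (g : Fin n → D) (g' : Fin n → D') : Prop where
  type : ∀ i, f (g i) = f' (g' i)
  eq : ∀ i j, g i = g j ↔ g' i = g' j

section Game

variable {τ : Type w} {D D' : Type u} {K : ℕ} {f : D → τ} {f' : D' → τ} {n : ℕ}
  {g : Fin n → D} {g' : Fin n → D'}

theorem CountEquiv.symm (h : CountEquiv K f f') : CountEquiv K f' f :=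
  ⟨fun S j hj => (h.card S j hj).symm, fun S => (h.infinite S).symm⟩

theorem PartialIso.symm (h : PartialIso f f' g g') : PartialIso f' f g' g :=
  ⟨fun i => (h.type i).symm, fun i j => (h.eq i j).symm⟩

theorem PartialIso.snoc_of_notMem (h : PartialIso f f' g g') {d : D} {d' : D'}
    (hd : d ∉ Set.range g) (hd' : d' ∉ Set.range g') (ht : f d = f' d') :
    PartialIso f f' (Fin.snoc (α := fun _ => D) g d) (Fin.snoc (α := fun _ => D') g' d') := by
  have h1 : ∀ i, g i ≠ d := fun i hi => hd ⟨i, hi⟩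
  have h2 : ∀ i, g' i ≠ d' := fun i hi => hd' ⟨i, hi⟩
  constructor
  · intro i
    refine Fin.lastCases ?_ (fun i => ?_) i
    · simpa using ht
    · simpa using h.type i
  · intro i j
    refine Fin.lastCases ?_ (fun i => ?_) i <;> refine Fin.lastCases ?_ (fun j => ?_) j
    · simp
    · simp [(h1 j).symm, (h2 j).symm]
    · simp [h1 i, h2 i]
    · simpa using h.eq i j

theorem PartialIso.snoc_apply (h : PartialIso f f' g g') (k : Fin n) :
    PartialIso f f' (Fin.snoc (α := fun _ => D) g (g k))
      (Fin.snoc (α := fun _ => D') g' (g' k)) := by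
  constructor
  · intro i
    refine Fin.lastCases ?_ (fun i => ?_) i
    · simpa using h.type k
    · simpa using h.type i
  · intro i j
    refine Fin.lastCases ?_ (fun i => ?_) i <;> refine Fin.lastCases ?_ (fun j => ?_) j
    · simp
    · simpa using h.eq k j
    · simpa using h.eq i k
    · simpa using h.eq i j

/-- A move in the back-and-forth game: if `d` is new, counting shows that its colour class in the
second domain is not exhausted by the tuple `g'` either. -/
theorem PartialIso.exists_snoc (h : PartialIso f f' g g') (hc : CountEquiv K f f') (hn : n < K)
    (d : D) : ∃ d', PartialIso f f' (Fin.snoc (α := fun _ => D) g d)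
      (Fin.snoc (α := fun _ => D') g' d') := by
  by_cases hd : d ∈ Set.range g
  · obtain ⟨k, rfl⟩ := hd
    exact ⟨g' k, h.snoc_apply k⟩
  by_contra hcon
  -- `I` selects one index for each point of colour `f d` in the range of `g`.
  have hsub : f' ⁻¹' {f d} ⊆ g' '' {i | f (g i) = f d} := by
    intro d' hd'
    by_contra h'
    refine hcon ⟨d', h.snoc_of_notMem hd (fun ⟨i, hi⟩ => h' ⟨i, ?_, hi⟩) hd'.symm⟩
    have : f' d' = f d := hd'
    simpa [h.type i, hi] using this
  obtain ⟨I, hI, hbij⟩ := (Set.surjOn_image g {i | f (g i) = f d}).exists_bijOn_subset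
  have hI' : g' '' {i | f (g i) = f d} ⊆ g' '' I := by
    rintro _ ⟨i, hi, rfl⟩
    obtain ⟨j, hj, hji⟩ := hbij.surjOn ⟨i, hi, rfl⟩
    exact ⟨j, hj, (h.eq j i).1 hji⟩
  have hle : (f' ⁻¹' {f d}).encard ≤ I.encard :=
    (Set.encard_le_encard (hsub.trans hI')).trans (Set.encard_image_le _ _)
  have hIn : I.encard ≤ n := by
    refine (Set.encard_le_encard (Set.subset_univ I)).trans ?_
    simp [Set.encard_univ]
  have hgt : I.encard + 1 ≤ (f ⁻¹' {f d}).encard := by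
    rw [← hbij.injOn.encard_image, ← Set.encard_insert_of_notMem (a := d)]
    · refine Set.encard_le_encard (Set.insert_subset rfl ?_)
      rintro _ ⟨i, hi, rfl⟩
      exact hI hi
    · rintro ⟨i, -, hi⟩
      exact hd ⟨i, hi⟩
  have hfinI : I.Finite := Set.toFinite I
  rw [hfinI.encard_eq_coe_toFinset_card] at hle hIn hgt
  have := (hc.card (f d) (hfinI.toFinset.card + 1) (by
    have : hfinI.toFinset.card ≤ n := by exact_mod_cast hIn
    omega)).1 (by exact_mod_cast hgt)
  have := this.trans hle
  norm_cast at this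
  omega

/-- A move for the quantifier `∃^∞`: by the pigeonhole principle some colour has infinitely many
witnesses, and then all new points of that colour in the second domain are witnesses. -/
theorem PartialIso.infinite_imp [Finite τ] (h : PartialIso f f' g g') (hc : CountEquiv K f f')
    {P : D → Prop} {P' : D' → Prop}
    (hP : ∀ d d', PartialIso f f' (Fin.snoc (α := fun _ => D) g d)
      (Fin.snoc (α := fun _ => D') g' d') → (P d → P' d'))
    (hinf : {d | P d}.Infinite) : {d' | P' d'}.Infinite := by
  have h1 : ({d | P d} \ Set.range g).Infinite := hinf.sdiff (Set.finite_range g)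
  obtain ⟨S, hS⟩ : ∃ S, (({d | P d} \ Set.range g) ∩ f ⁻¹' {S}).Infinite := by
    by_contra hcon
    push Not at hcon
    exact h1 (Set.Finite.of_finite_fibers f (Set.toFinite _) fun S _ => by
      simpa using hcon S)
  obtain ⟨d, ⟨hd, hdg⟩, hdS⟩ := hS.nonempty
  have h2 := (hc.infinite S).1 (hS.mono Set.inter_subset_right)
  refine (h2.sdiff (Set.finite_range g')).mono ?_
  rintro d' ⟨hd', hdg'⟩
  refine hP d d' (h.snoc_of_notMem hdg hdg' ?_) hd
  rw [hdS, hd']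

theorem sat_iff_of_partialIso [Finite τ] {A : Type v} {V : A → Set D} {V' : A → Set D'}
    (hV : ∀ d d', f d = f' d' → ∀ a, d ∈ V a ↔ d' ∈ V' a) (hc : CountEquiv K f f') {n : ℕ}
    (φ : OneStep A n) : ∀ (g : Fin n → D) (g' : Fin n → D'), PartialIso f f' g g' →
      n + φ.rank ≤ K → (Sat V φ g ↔ Sat V' φ g') := by
  induction φ with
  | tru | fls => exact fun _ _ _ _ => Iff.rfl
  | pred a x => exact fun g g' h _ => hV _ _ (h.type x) a
  | eq x y => exact fun g g' h _ => h.eq x y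
  | neg φ ih => exact fun g g' h hK => not_congr (ih g g' h hK)
  | and φ ψ ih ih' =>
    intro g g' h hK
    have h1 := le_max_left φ.rank ψ.rank
    have h2 := le_max_right φ.rank ψ.rank
    simp only [rank] at hK
    exact and_congr (ih g g' h (by omega)) (ih' g g' h (by omega))
  | or φ ψ ih ih' =>
    intro g g' h hK
    have h1 := le_max_left φ.rank ψ.rank
    have h2 := le_max_right φ.rank ψ.rank
    simp only [rank] at hK
    exact or_congr (ih g g' h (by omega)) (ih' g g' h (by omega))
  | ex φ ih =>
    intro g g' h hK
    simp only [rank] at hK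
    constructor
    · rintro ⟨d, hd⟩
      obtain ⟨d', h'⟩ := h.exists_snoc hc (by omega) d
      exact ⟨d', (ih _ _ h' (by omega)).1 hd⟩
    · rintro ⟨d', hd'⟩
      obtain ⟨d, h'⟩ := h.symm.exists_snoc hc.symm (by omega) d'
      exact ⟨d, (ih _ _ h'.symm (by omega)).2 hd'⟩
  | all φ ih =>
    intro g g' h hK
    simp only [rank] at hK
    constructor
    · intro H d'
      obtain ⟨d, h'⟩ := h.symm.exists_snoc hc.symm (by omega) d'
      exact (ih _ _ h'.symm (by omega)).1 (H d)
    · intro H d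
      obtain ⟨d', h'⟩ := h.exists_snoc hc (by omega) d
      exact (ih _ _ h' (by omega)).2 (H d')
  | exInf φ ih =>
    intro g g' h hK
    simp only [rank] at hK
    exact ⟨h.infinite_imp hc fun d d' h' => (ih _ _ h' (by omega)).1,
      h.symm.infinite_imp hc.symm fun d' d h' => (ih _ _ h'.symm (by omega)).2⟩
  | allInf φ ih =>
    intro g g' h hK
    simp only [rank] at hK
    refine not_iff_not.1 ⟨h.infinite_imp hc fun d d' h' => mt (ih _ _ h' (by omega)).2,
      h.symm.infinite_imp hc.symm fun d' d h' => mt (ih _ _ h'.symm (by omega)).1⟩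

theorem holds_iff_of_countEquiv [Finite τ] {A : Type v} {V : A → Set D} {V' : A → Set D'}
    (hV : ∀ d d', f d = f' d' → ∀ a, d ∈ V a ↔ d' ∈ V' a) {φ : Sentence A}
    (hc : CountEquiv φ.rank f f') : Holds V φ ↔ Holds V' φ :=
  sat_iff_of_partialIso hV hc φ _ _ ⟨fun i => i.elim0, fun i => i.elim0⟩ (by simp)

end Game

/-! ### Positive basic normal form -/

/-- A description of a monadic structure over `B` up to quantifier rank `K`: the number of points of
each type, truncated at `K`, and the set of types that are realized infinitely often. -/
structure Profile (B : Type v) (K : ℕ) where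
  count : Finset B → Fin (K + 1)
  inf : Finset (Finset B)

section Profile

variable {B : Type v} {K : ℕ}

instance [Finite B] : Finite (Profile B K) :=
  Finite.of_injective (fun p => (p.count, p.inf)) fun p q h => by
    cases p; cases q; simpa using h

/-- `p` is the profile of the structure in which the point `d` has type `f d`. -/
structure Profile.Describes {D : Type u} (p : Profile B K) (f : D → Finset B) : Prop where
  count : ∀ S, ∀ j ≤ K, j ≤ (p.count S : ℕ) ↔ (j : ℕ∞) ≤ (f ⁻¹' {S}).encard
  inf : ∀ S, S ∈ p.inf ↔ (f ⁻¹' {S}).Infinite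

open Classical in
theorem Profile.exists_describes [Finite B] {D : Type u} (K : ℕ) (f : D → Finset B) :
    ∃ p : Profile B K, p.Describes f := by
  have := Fintype.ofFinite (Finset B)
  have h : ∀ S, ∃ c : Fin (K + 1), ∀ j ≤ K, j ≤ (c : ℕ) ↔ (j : ℕ∞) ≤ (f ⁻¹' {S}).encard := by
    intro S
    rcases (f ⁻¹' {S}).finite_or_infinite with h | h
    · refine ⟨⟨min h.toFinset.card K, by omega⟩, fun j hj => ?_⟩
      rw [h.encard_eq_coe_toFinset_card, Nat.cast_le]
      simp [hj]
    · exact ⟨Fin.last K, fun j hj => by simp [h.encard_eq, hj]⟩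
  choose c hc using h
  exact ⟨⟨c, Finset.univ.filter fun S => (f ⁻¹' {S}).Infinite⟩, hc, by simp⟩

theorem Profile.Describes.countEquiv {D D' : Type u} {p : Profile B K} {f : D → Finset B}
    {f' : D' → Finset B} (h : p.Describes f) (h' : p.Describes f') : CountEquiv K f f' :=
  ⟨fun S j hj => (h.count S j hj).symm.trans (h'.count S j hj),
    fun S => (h.inf S).symm.trans (h'.inf S)⟩

open Classical in
/-- The basic form of a profile: `T̄` lists every type as often as it is counted, `Π` consists of the
types whose count reaches the threshold, and `Σ` of the types realized infinitely often. -/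
noncomputable def Profile.basicForm [Fintype B] (p : Profile B K) : BasicForm B where
  k := Fintype.card (Σ S, Fin (p.count S))
  T i := ((Fintype.equivFin (Σ S, Fin (p.count S))).symm i).1
  Pi := Finset.univ.filter fun S => (p.count S : ℕ) = K
  Sig := p.inf

/-- The positions of `T̄`, indexed by a type and a number below its count. -/
noncomputable def Profile.slot [Fintype B] (p : Profile B K) :
    (Σ S, Fin (p.count S)) ≃ Fin p.basicForm.k :=
  Fintype.equivFin _

theorem Profile.basicForm_T_slot [Fintype B] (p : Profile B K) (y : Σ S, Fin (p.count S)) :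
    p.basicForm.T (p.slot y) = y.1 :=
  congrArg Sigma.fst (p.slot.symm_apply_apply y)

theorem Profile.Describes.holds_basicForm [Fintype B] {D : Type u} {p : Profile B K}
    {V : B → Set D} {f : D → Finset B} (hf : ∀ d b, b ∈ f d ↔ d ∈ V b) (h : p.Describes f) :
    Holds V p.basicForm.toSentence := by
  classical
  have hx : ∀ S, ∃ x : Fin (p.count S) → D, Function.Injective x ∧ (∀ i, f (x i) = S) ∧
      ((p.count S : ℕ) < K → ∀ d, f d = S → ∃ i, x i = d) := by
    intro S
    have h1 := (h.count S (p.count S) (by omega)).1 le_rfl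
    obtain ⟨t, ht, htc⟩ := Set.exists_subset_encard_eq h1
    have htf : t.Finite := Set.finite_of_encard_eq_coe htc
    have hcard : htf.toFinset.card = p.count S := by
      rw [htf.encard_eq_coe_toFinset_card] at htc
      exact_mod_cast htc
    let e := (Finset.equivFinOfCardEq hcard).symm
    have hmem : ∀ i, (e i : D) ∈ t := fun i => htf.mem_toFinset.1 (e i).2
    refine ⟨fun i => e i, Subtype.val_injective.comp e.injective, fun i => ht (hmem i), ?_⟩
    intro hlt d hd
    have hdt : d ∈ t := by
      by_contra hdt
      have h2 : ((p.count S + 1 : ℕ) : ℕ∞) ≤ (f ⁻¹' {S}).encard := by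
        push_cast
        rw [← htc, ← Set.encard_insert_of_notMem hdt]
        exact Set.encard_le_encard (Set.insert_subset hd ht)
      have := (h.count S _ hlt).2 h2
      omega
    exact ⟨e.symm ⟨d, htf.mem_toFinset.2 hdt⟩, by simp⟩
  choose x hx1 hx2 hx3 using hx
  refine (p.basicForm.holds_toSentence V).2 ⟨⟨fun i =>
    x (p.slot.symm i).1 (p.slot.symm i).2, ?_, ?_, ?_⟩, ?_, ?_⟩
  · refine Function.Injective.comp (g := fun y : Σ S, Fin (p.count S) => x y.1 y.2) ?_
      (Equiv.injective _)
    rintro ⟨S, i⟩ ⟨S', i'⟩ hii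
    obtain rfl : S = S' := by
      have := congrArg f hii
      simpa [hx2] using this
    simpa using hx1 S hii
  · intro i b hb
    rw [← hf, hx2]
    exact hb
  · intro z hz
    refine ⟨f z, ?_, fun b hb => (hf z b).1 hb⟩
    have hle : (p.count (f z) : ℕ) ≤ K := by omega
    rcases hle.lt_or_eq with hlt | heq
    · obtain ⟨i, hi⟩ := hx3 _ hlt z rfl
      refine (hz ⟨p.slot ⟨f z, i⟩, ?_⟩).elim
      exact (congrArg (fun y : Σ S, Fin (p.count S) => x y.1 y.2)
        (p.slot.symm_apply_apply _)).trans hi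
    · exact Or.inl (by simp [basicForm, heq])
  · intro S hS
    refine ((h.inf S).1 hS).mono fun d hd b hb => (hf d b).1 ?_
    have hd : f d = S := hd
    rwa [hd]
  · have : (⋃ S ∈ (p.inf : Set (Finset B))ᶜ, f ⁻¹' {S}).Finite :=
      (Set.toFinite _).biUnion fun S hS => by simpa [h.inf] using hS
    refine this.subset fun d hd => ?_
    simp only [Set.mem_iUnion]
    exact ⟨f d, fun hm => hd ⟨f d, hm, fun b hb => (hf d b).1 hb⟩, rfl⟩

/-- A model of the basic form of a profile can be shrunk to a structure with exactly this profile. -/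
theorem Profile.Describes.exists_of_holds_basicForm [Fintype B] {D D' : Type u} {p : Profile B K}
    {f : D → Finset B} (h : p.Describes f) {V' : B → Set D'}
    (hV' : Holds V' p.basicForm.toSentence) :
    ∃ f' : D' → Finset B, p.Describes f' ∧ ∀ d, ∀ b ∈ f' d, d ∈ V' b := by
  classical
  obtain ⟨⟨x, hx, hT, hz⟩, hinf, hfin⟩ := (p.basicForm.holds_toSentence V').1 hV'
  obtain ⟨g, M, hM, -, hxM, hgx, hgL, hgM, hgM', hginf⟩ := exists_type_assignment
    (p := fun S z => ∀ b ∈ S, z ∈ V' b) (q := fun S z => ∀ b ∈ S, z ∈ V' b)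
    (L := {S | S ∈ p.basicForm.Pi ∨ S ∈ p.basicForm.Sig})
    Set.finite_empty (fun _ => Or.inr) hx hT
    (fun z hzx _ => hz z hzx) hinf hfin
  have hfull : ∀ S ∈ p.inf, (p.count S : ℕ) = K := fun S hS => by
    have := (h.count S K le_rfl).2 (by simp [((h.inf S).1 hS).encard_eq])
    omega
  have hinf' : ∀ S ∈ p.inf, (g ⁻¹' {S}).Infinite := fun S hS =>
    (hginf S hS).mono fun z hz => hz.2
  refine ⟨g, ⟨fun S j hj => ?_, fun S => ⟨hinf' S, fun hS => ?_⟩⟩, fun d => ?_⟩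
  · have hrange : (Set.range fun i : Fin (p.count S) => x (p.slot ⟨S, i⟩)).encard = p.count S := by
      rw [← Set.image_univ, Function.Injective.encard_image, Set.encard_univ]
      · simp
      · intro i j hij
        simpa using p.slot.injective (hx hij)
    have hsub : (Set.range fun i : Fin (p.count S) => x (p.slot ⟨S, i⟩)) ⊆ g ⁻¹' {S} := by
      rintro _ ⟨i, rfl⟩
      have : g (x (p.slot ⟨S, i⟩)) = S := by
        rw [hgx, basicForm_T_slot]
      exact this
    constructor
    · intro hjc
      refine le_trans ?_ (Set.encard_le_encard hsub)
      rw [hrange]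
      exact_mod_cast hjc
    · intro hjc
      by_cases hK : (p.count S : ℕ) = K
      · omega
      · have : g ⁻¹' {S} ⊆ Set.range fun i : Fin (p.count S) => x (p.slot ⟨S, i⟩) := by
          intro z hzS
          have hzS : g z = S := hzS
          by_contra hzr
          have hzx : z ∉ Set.range x := by
            rintro ⟨i, rfl⟩
            apply hzr
            obtain ⟨⟨S', i'⟩, rfl⟩ := p.slot.surjective i
            obtain rfl : S' = S := by
              rw [← hzS, hgx, basicForm_T_slot]
            exact ⟨i', rfl⟩
          rcases hgL z hzx with hm | hm
          · rw [hzS] at hm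
            exact hK (by simpa [basicForm] using hm)
          · rw [hzS] at hm
            exact hK (hfull S hm)
        have h3 := hjc.trans (Set.encard_le_encard this)
        rw [hrange] at h3
        exact_mod_cast h3
  · by_contra hSi
    refine hS (hM.subset fun z hz => ?_)
    by_contra hzM
    have hz : g z = S := hz
    exact hSi (hz ▸ (hgM z hzM).1)
  · by_cases hd : d ∈ M
    exacts [hgM' d hd, (hgM d hd).2]

end Profile

/-- The disjuncts are the basic forms of the profiles of all models of `φ`. Shrinking a model of such
a form to the profile of a model of `φ` gives a model of `φ` by invariance, and positivity transfers
the truth of `φ` back to the larger valuation. -/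
theorem exists_basicDisj_equivalent {B : Type v} [Finite B] {φ : Sentence B} (hφ : Positive φ) :
    ∃ l : List (BasicForm B), Equivalent.{u} (basicDisj l) φ := by
  classical
  have := Fintype.ofFinite B
  have := Fintype.ofFinite (Profile B φ.rank)
  have htype : ∀ {D : Type u} (V : B → Set D), ∃ f : D → Finset B, ∀ d b, b ∈ f d ↔ d ∈ V b :=
    fun V => ⟨fun d => Finset.univ.filter fun b => d ∈ V b, by simp⟩
  refine ⟨((Finset.univ : Finset (Profile B φ.rank)).filter fun p =>
    ∃ (D : Type u) (V : B → Set D) (f : D → Finset B), (∀ d b, b ∈ f d ↔ d ∈ V b) ∧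
      p.Describes f ∧ Holds V φ).toList.map Profile.basicForm, fun D V => ?_⟩
  simp only [holds_basicDisj, List.mem_map, Finset.mem_toList, Finset.mem_filter,
    Finset.mem_univ, true_and]
  constructor
  · rintro ⟨_, ⟨p, ⟨D₀, V₀, f₀, hf₀, hp, h₀⟩, rfl⟩, h⟩
    obtain ⟨f, hf, hfV⟩ := hp.exists_of_holds_basicForm h
    refine hφ.holds_mono (V := fun b => {d | b ∈ f d}) (fun b d hd => hfV d b hd) ?_
    refine (holds_iff_of_countEquiv (fun d d' hdd b => ?_) (hp.countEquiv hf)).1 h₀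
    rw [← hf₀, hdd]
    rfl
  · intro h
    obtain ⟨f, hf⟩ := htype V
    obtain ⟨p, hp⟩ := Profile.exists_describes φ.rank f
    exact ⟨_, ⟨p, ⟨D, V, f, hf, hp, h⟩, rfl⟩, hp.holds_basicForm hf⟩

theorem ParityAutomaton.exists_isBasicChoice {C : Type w} (𝔸 : ParityAutomaton.{v, w} C) :
    ∃ Ψ, IsBasicChoice.{u} 𝔸 Ψ := by
  have := 𝔸.finite
  have h : ∀ Q c, ∃ l, Equivalent.{u} (basicDisj l) (𝔸.starConj Q c) := fun Q c =>
    exists_basicDisj_equivalent (positive_conj fun φ hφ => by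
      obtain ⟨a, -, rfl⟩ := List.mem_map.1 hφ
      exact polarity_rename _ _ _ (𝔸.positive a c))
  choose Ψ hΨ using h
  exact ⟨Ψ, hΨ⟩

/-! ### Acceptance games in terms of basic positions -/

/-- The least number that the sequence takes infinitely often exists and is even. -/
def LeastEven (p : ℕ → ℕ) : Prop :=
  ∃ n : ℕ, Even n ∧ (∃ᶠ i in Filter.atTop, p i = n) ∧ ∀ m < n, ¬ ∃ᶠ i in Filter.atTop, p i = m

theorem frequently_atTop_add_iff (P : ℕ → Prop) (k : ℕ) :
    (∃ᶠ i in Filter.atTop, P (i + k)) ↔ ∃ᶠ i in Filter.atTop, P i := by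
  conv_rhs => rw [← Filter.map_add_atTop_eq_nat k, Filter.frequently_map]

theorem leastEven_add_iff (p : ℕ → ℕ) (k : ℕ) : LeastEven (fun i => p (i + k)) ↔ LeastEven p := by
  have h := fun n => frequently_atTop_add_iff (fun i => p i = n) k
  simp only [LeastEven, h]

/-- Inserting an upper bound of the priorities at every other place does not change the winner. This
removes the positions `V` from matches of the acceptance game. -/
theorem leastEven_interleave_iff {p q : ℕ → ℕ} {N : ℕ} (hp : ∀ i, p i ≤ N)
    (h0 : ∀ i, q (2 * i) = p i) (h1 : ∀ i, q (2 * i + 1) = N) : LeastEven q ↔ LeastEven p := by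
  have hq : ∀ n, (∃ᶠ i in Filter.atTop, q i = n) ↔ (∃ᶠ i in Filter.atTop, p i = n) ∨ n = N := by
    intro n
    simp only [Filter.frequently_atTop]
    constructor
    · intro h
      by_contra! hcon
      obtain ⟨⟨a, ha⟩, hn⟩ := hcon
      obtain ⟨b, hb, hbn⟩ := h (2 * a)
      rcases Nat.even_or_odd' b with ⟨c, rfl | rfl⟩
      · exact ha c (by omega) (h0 c ▸ hbn)
      · exact hn (hbn ▸ h1 c)
    · rintro (h | rfl) a
      · obtain ⟨b, hb, hbn⟩ := h a
        exact ⟨2 * b, by omega, (h0 b).trans hbn⟩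
      · exact ⟨2 * a + 1, by omega, h1 a⟩
  have hpf : ∃ m ≤ N, ∃ᶠ i in Filter.atTop, p i = m := by
    by_contra! hcon
    have : ∀ᶠ i in Filter.atTop, ∀ m ∈ Set.Iic N, p i ≠ m :=
      (Set.finite_Iic N).eventually_all.2 fun m hm => hcon m hm
    obtain ⟨i, hi⟩ := this.exists
    exact hi (p i) (hp i) rfl
  constructor
  · rintro ⟨n, hn, hf, hmin⟩
    have hmin' : ∀ m < n, ¬ ∃ᶠ i in Filter.atTop, p i = m := fun m hm h =>
      hmin m hm ((hq m).2 (Or.inl h))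
    refine ⟨n, hn, ?_, hmin'⟩
    rcases (hq n).1 hf with h | rfl
    · exact h
    · obtain ⟨m, hm, hmf⟩ := hpf
      rcases hm.lt_or_eq with hlt | rfl
      exacts [(hmin' m hlt hmf).elim, hmf]
  · rintro ⟨n, hn, hf, hmin⟩
    refine ⟨n, hn, (hq n).2 (Or.inl hf), fun m hm h => ?_⟩
    rcases (hq m).1 h with h | rfl
    · exact hmin m hm h
    · obtain ⟨i, hi⟩ := hf.exists
      have := hp i
      omega

namespace ParityGame

theorem Winning.of_guidedStep {G : ParityGame.{u}} {f : G.Pos → G.Pos} {x y : G.Pos}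
    (hx : G.Winning x f) (h : G.GuidedStep f x y) : G.Winning y f := by
  constructor
  · intro k π h0 hπ hk
    refine hx.1 (k + 1) (fun i => Nat.casesOn i x π) rfl (fun i hi => ?_) hk
    cases i with
    | zero =>
      subst h0
      exact h
    | succ i => exact hπ i (by omega)
  · intro π h0 hπ
    refine (leastEven_add_iff _ 1).2 (hx.2 (fun i => Nat.casesOn i x π) rfl fun i => ?_)
    cases i with
    | zero =>
      subst h0
      exact h
    | succ i => exact hπ i

end ParityGame

namespace ParityAutomaton

variable {C : Type w}

/-- `F` is a positional strategy of `∃` in the acceptance game, described on basic positions only: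
at `(a, s)` she plays the valuation `F a s`. It is admissible on the set `I` of positions, which is
closed under it, and it wins all infinite matches inside `I`. -/
structure IsStrategy (𝔸 : ParityAutomaton.{v, w} C) (𝕋 : LTS.{u, w} C)
    (F : 𝔸.State → 𝕋.Node → 𝔸.State → Set 𝕋.Node) (I : 𝔸.State → 𝕋.Node → Prop) : Prop where
  subset : ∀ {a s}, I a s → ∀ {b t}, t ∈ F a s b → 𝕋.R s t
  holds : ∀ {a s}, I a s →
    Holds (D := {t : 𝕋.Node // 𝕋.R s t}) (fun b => {t | t.1 ∈ F a s b}) (𝔸.Δ a (𝕋.label s))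
  closed : ∀ {a s}, I a s → ∀ {b t}, t ∈ F a s b → I b t
  wins : ∀ (α : ℕ → 𝔸.State) (σ : ℕ → 𝕋.Node), (∀ i, I (α i) (σ i)) →
    (∀ i, σ (i + 1) ∈ F (α i) (σ i) (α (i + 1))) → LeastEven fun i => 𝔸.Ω (α i)

theorem Ω_le_iSup (𝔸 : ParityAutomaton.{v, w} C) (a : 𝔸.State) : 𝔸.Ω a ≤ ⨆ b, 𝔸.Ω b :=
  have := 𝔸.finite
  le_ciSup (Set.finite_range 𝔸.Ω).bddAbove a

open ParityGame in
/-- The set `I` consists of the positions from which the given strategy is winning. -/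
theorem Accepts.exists_isStrategy {𝔸 : ParityAutomaton.{v, w} C} {𝕋 : LTS.{u, w} C}
    (h : 𝔸.Accepts 𝕋) : ∃ F I, 𝔸.IsStrategy 𝕋 F I ∧ I 𝔸.init 𝕋.root := by
  obtain ⟨f, hf⟩ := h
  let I : 𝔸.State → 𝕋.Node → Prop := fun a s => (𝔸.game 𝕋).Winning (.basic a s) f
  have hmove : ∀ {a s}, I a s → ∃ V, f (.basic a s) = .val V ∧
      𝔸.GameMove 𝕋 (.basic a s) (.val V) := by
    intro a s hI
    have h1 := hI.1 0 (fun _ => .basic a s) rfl (fun i hi => by omega) ⟨a, s, rfl⟩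
    generalize f (.basic a s) = y at h1
    cases y with
    | basic b t => exact h1.elim
    | val V => exact ⟨V, rfl, h1⟩
  have hV : ∀ a s, ∃ V : 𝔸.State → Set 𝕋.Node, I a s → f (.basic a s) = .val V ∧
      𝔸.GameMove 𝕋 (.basic a s) (.val V) := by
    intro a s
    by_cases hI : I a s
    · obtain ⟨V, hV⟩ := hmove hI
      exact ⟨V, fun _ => hV⟩
    · exact ⟨fun _ => ∅, fun h => (hI h).elim⟩
  choose F hF using hV
  have hstep1 : ∀ {a s}, I a s → (𝔸.game 𝕋).GuidedStep f (.basic a s) (.val (F a s)) :=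
    fun hI => ⟨(hF _ _ hI).2, fun _ => (hF _ _ hI).1.symm⟩
  have hstep2 : ∀ {a s b t}, t ∈ F a s b → (𝔸.game 𝕋).GuidedStep f (.val (F a s)) (.basic b t) :=
    fun ht => ⟨ht, fun ⟨_, _, he⟩ => by cases he⟩
  refine ⟨F, I, ⟨fun hI b t ht => (hF _ _ hI).2.1 b ht, fun hI => (hF _ _ hI).2.2,
    fun hI b t ht => (Winning.of_guidedStep hI (hstep1 hI)).of_guidedStep (hstep2 ht),
    fun α σ hI hσ => ?_⟩, hf⟩
  let π : ℕ → GamePos 𝔸.State 𝕋.Node := fun j =>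
    if Even j then .basic (α (j / 2)) (σ (j / 2)) else .val (F (α (j / 2)) (σ (j / 2)))
  have h0 : ∀ i, π (2 * i) = .basic (α i) (σ i) := fun i => by simp [π]
  have h1 : ∀ i, π (2 * i + 1) = .val (F (α i) (σ i)) := fun i => by
    have : (2 * i + 1) / 2 = i := by omega
    simp [π, this]
  refine (leastEven_interleave_iff (q := fun j => (𝔸.game 𝕋).Ω (π j)) (fun i => 𝔸.Ω_le_iSup _)
    (fun i => ?_) (fun i => ?_)).1 ((hI 0).2 π (h0 0) fun j => ?_)
  · rw [h0]; rfl
  · rw [h1]; rfl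
  · rcases Nat.even_or_odd' j with ⟨i, rfl | rfl⟩
    · rw [h0, h1]
      exact hstep1 (hI i)
    · rw [h1, show 2 * i + 1 + 1 = 2 * (i + 1) by ring, h0]
      exact hstep2 (hσ i)

theorem IsStrategy.accepts {𝔸 : ParityAutomaton.{v, w} C} {𝕋 : LTS.{u, w} C}
    {F : 𝔸.State → 𝕋.Node → 𝔸.State → Set 𝕋.Node} {I : 𝔸.State → 𝕋.Node → Prop}
    (h : 𝔸.IsStrategy 𝕋 F I) (h0 : I 𝔸.init 𝕋.root) : 𝔸.Accepts 𝕋 := by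
  let f : (𝔸.game 𝕋).Pos → (𝔸.game 𝕋).Pos := fun x =>
    match x with
    | .basic a s => .val (F a s)
    | .val V => .val V
  have hval : ∀ {a s y}, (𝔸.game 𝕋).GuidedStep f (.basic a s) y → y = .val (F a s) :=
    fun hy => hy.2 ⟨_, _, rfl⟩
  have hbasic : ∀ {a s y}, I a s → (𝔸.game 𝕋).GuidedStep f (.val (F a s)) y →
      ∃ b t, t ∈ F a s b ∧ I b t ∧ y = .basic b t := by
    intro a s y hI hy
    cases y with
    | basic b t => exact ⟨b, t, hy.1, h.closed hI hy.1, rfl⟩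
    | val V => exact hy.1.elim
  refine ⟨f, fun k π hπ0 hπ hk => ?_, fun π hπ0 hπ => ?_⟩
  · have inv : ∀ i ≤ k, ∃ a s, I a s ∧ (π i = .basic a s ∨ π i = .val (F a s)) := by
      intro i
      induction i with
      | zero => exact fun _ => ⟨_, _, h0, Or.inl hπ0⟩
      | succ i ih =>
        intro hi
        obtain ⟨a, s, hI, h1 | h1⟩ := ih (by omega)
        · have := hπ i (by omega)
          rw [h1] at this
          exact ⟨a, s, hI, Or.inr (hval this)⟩
        · have := hπ i (by omega)
          rw [h1] at this
          obtain ⟨b, t, -, hI', h2⟩ := hbasic hI this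
          exact ⟨b, t, hI', Or.inl h2⟩
    obtain ⟨a, s, hI, h1 | h1⟩ := inv k le_rfl
    · rw [h1]
      exact ⟨fun b t ht => h.subset hI ht, h.holds hI⟩
    · obtain ⟨b, t, hbt⟩ := hk
      rw [h1] at hbt
      cases hbt
  · have inv : ∀ i, ∃ a s, I a s ∧ π (2 * i) = .basic a s := by
      intro i
      induction i with
      | zero => exact ⟨_, _, h0, hπ0⟩
      | succ i ih =>
        obtain ⟨a, s, hI, h1⟩ := ih
        have h2 := hπ (2 * i)
        rw [h1] at h2
        have h3 := hπ (2 * i + 1)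
        rw [hval h2] at h3
        obtain ⟨b, t, -, hI', h4⟩ := hbasic hI h3
        exact ⟨b, t, hI', h4⟩
    choose α σ hI hπe using inv
    have hπo : ∀ i, π (2 * i + 1) = .val (F (α i) (σ i)) := fun i => by
      have h2 := hπ (2 * i)
      rw [hπe] at h2
      exact hval h2
    have hσ : ∀ i, σ (i + 1) ∈ F (α i) (σ i) (α (i + 1)) := fun i => by
      have h3 := (hπ (2 * i + 1)).1
      rw [hπo, show 2 * i + 1 + 1 = 2 * (i + 1) by ring, hπe] at h3
      exact h3
    refine (leastEven_interleave_iff (p := fun i => 𝔸.Ω (α i)) (fun i => 𝔸.Ω_le_iSup _)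
      (fun i => ?_) (fun i => ?_)).2 (h.wins α σ hI hσ)
    · rw [hπe]; rfl
    · rw [hπo]; rfl

end ParityAutomaton

/-! ### Ancestors and branches in trees -/

namespace Tree

variable {C : Type w} (𝕋 : Tree.{u, w} C)

theorem parent_unique {s s' t : 𝕋.Node} (h : 𝕋.R s t) (h' : 𝕋.R s' t) : s = s' :=
  (𝕋.unique_pred t fun he => 𝕋.root_no_pred s (he ▸ h)).unique h h'

theorem wellFounded_R : WellFounded 𝕋.R := by
  refine ⟨fun s => ?_⟩
  induction 𝕋.reachable s with
  | refl => exact ⟨_, fun t ht => (𝕋.root_no_pred t ht).elim⟩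
  | tail _ hst ih => exact ⟨_, fun t ht => 𝕋.parent_unique hst ht ▸ ih⟩

theorem finite_ancestors (s : 𝕋.Node) : {t | Relation.ReflTransGen 𝕋.R t s}.Finite := by
  induction 𝕋.reachable s with
  | refl =>
    refine (Set.finite_singleton 𝕋.root).subset fun t ht => ?_
    rcases Relation.ReflTransGen.cases_tail ht with h | ⟨t', -, h⟩
    exacts [h.symm, (𝕋.root_no_pred _ h).elim]
  | @tail b c _ hbc ih =>
    refine (ih.insert c).subset fun t ht => ?_
    rcases Relation.ReflTransGen.cases_tail ht with h | ⟨t', h', h⟩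
    · exact Or.inl h.symm
    · exact Or.inr (𝕋.parent_unique hbc h ▸ h')

theorem injective_of_path {σ : ℕ → 𝕋.Node} (h : ∀ i, 𝕋.R (σ i) (σ (i + 1))) :
    Function.Injective σ := by
  refine Function.Injective.of_lt_imp_ne fun i j hij e => ?_
  have hT : Relation.TransGen 𝕋.R (σ i) (σ j) :=
    Nat.rel_of_forall_rel_succ_of_lt (Relation.TransGen 𝕋.R) (fun k => .single (h k)) hij
  exact (WellFounded.irrefl 𝕋.wellFounded_R.transGen).irrefl _ (e ▸ hT)

end Tree

/-! ### One-step semantics of the finitary lifting -/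

section Lifting

variable {A : Type v} {D : Type u}

theorem forall_mem_liftType {S : Macro A} {P : A ⊕ Macro A → Prop} :
    (∀ b ∈ liftType S, P b) ↔ S = ∅ ∨ P (Sum.inr S) := by
  classical
  by_cases h : S = ∅ <;> simp [liftType, h]

theorem mem_ran {Q : Macro A} {b : A} : b ∈ ran Q ↔ ∃ a, (a, b) ∈ Q := by
  simp [ran]

theorem forall_mem_ranType {S : Macro A} {P : A ⊕ Macro A → Prop} [DecidableEq (A ⊕ Macro A)] :
    (∀ b ∈ (ran S).image Sum.inl, P b) ↔ ∀ a ∈ ran S, P (Sum.inl a) := by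
  simp

theorem BasicForm.mem_finLift_Pi {β : BasicForm (A × A)} {S' : Finset (A ⊕ Macro A)} :
    S' ∈ β.finLift.Pi ↔ ∃ S, (S ∈ β.Pi ∨ S ∈ β.Sig) ∧ liftType S = S' := by
  classical
  simp only [finLift, liftTypes, Finset.mem_union, Finset.mem_image]
  grind

theorem BasicForm.holds_finLift {β : BasicForm (A × A)} {V : A ⊕ Macro A → Set D} :
    Holds V β.finLift.toSentence ↔
      (∃ x : Fin β.k → D, Function.Injective x ∧ (∀ i, β.T i = ∅ ∨ x i ∈ V (.inr (β.T i))) ∧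
        ∀ z ∉ Set.range x, (∃ S, (S ∈ β.Pi ∨ S ∈ β.Sig) ∧ (S = ∅ ∨ z ∈ V (.inr S))) ∨
          ∃ S ∈ β.Sig, ∀ b ∈ ran S, z ∈ V (.inl b)) ∧
      (∀ S ∈ β.Sig, {y | ∀ b ∈ ran S, y ∈ V (.inl b)}.Infinite) ∧
      {y | ¬ ∃ S ∈ β.Sig, ∀ b ∈ ran S, y ∈ V (.inl b)}.Finite := by
  classical
  have hsig : ∀ P : Finset (A ⊕ Macro A) → Prop, (∃ S' ∈ β.finLift.Sig, P S') ↔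
      ∃ S ∈ β.Sig, P ((ran S).image Sum.inl) := fun P => by
    simp only [finLift, ranTypes, Finset.mem_image]
    grind
  refine (β.finLift.holds_toSentence V).trans (and_congr (exists_congr fun x =>
    and_congr_right fun _ => and_congr (forall_congr' fun i => forall_mem_liftType)
      (forall₂_congr fun z _ => ?_)) (and_congr ?_ ?_))
  · constructor
    · rintro ⟨S', hS' | hS', h⟩
      · obtain ⟨S, hS, rfl⟩ := mem_finLift_Pi.1 hS'
        exact Or.inl ⟨S, hS, forall_mem_liftType.1 h⟩
      · obtain ⟨S, hS, h⟩ := (hsig fun S' => ∀ b ∈ S', z ∈ V b).1 ⟨S', hS', h⟩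
        exact Or.inr ⟨S, hS, forall_mem_ranType.1 h⟩
    · rintro (⟨S, hS, h⟩ | ⟨S, hS, h⟩)
      · exact ⟨_, Or.inl (mem_finLift_Pi.2 ⟨S, hS, rfl⟩), forall_mem_liftType.2 h⟩
      · obtain ⟨S', hS', h⟩ := (hsig fun S' => ∀ b ∈ S', z ∈ V b).2
          ⟨S, hS, forall_mem_ranType.2 h⟩
        exact ⟨S', Or.inr hS', h⟩
  · simp only [finLift, ranTypes, Finset.mem_image, forall_exists_index, and_imp,
      forall_apply_eq_imp_iff₂]
  · simp only [hsig, forall_mem_ranType]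

/-- A model of `∇⁺(T̄, Π, Σ)^F` yields a model of `∇⁺(T̄, Π, Σ)` on the same domain: every point gets
one type, witnessed by a macro-state on a finite set `M` and by its range elsewhere. -/
theorem BasicForm.exists_of_holds_finLift {β : BasicForm (A × A)} {V : A ⊕ Macro A → Set D}
    (h : Holds V β.finLift.toSentence) :
    ∃ (G : D → Macro A) (M : Set D), M.Finite ∧ (∀ z ∈ M, G z = ∅ ∨ z ∈ V (.inr (G z))) ∧
      (∀ z ∉ M, ∀ b ∈ ran (G z), z ∈ V (.inl b)) ∧
      Holds (fun e => {z | e ∈ G z}) β.toSentence := by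
  obtain ⟨⟨x, hx, hT, hz⟩, hinf, hfin⟩ := holds_finLift.1 h
  obtain ⟨G, M, hM, -, -, hGx, hGL, hGM, hGM', hGinf⟩ := exists_type_assignment
    (p := fun S z => ∀ b ∈ ran S, z ∈ V (.inl b)) (q := fun S z => S = ∅ ∨ z ∈ V (.inr S))
    (L := {S | S ∈ β.Pi ∨ S ∈ β.Sig}) Set.finite_empty (fun _ => Or.inr) hx hT
    (fun z hzx h => (hz z hzx).resolve_right (h.resolve_right fun h => h.elim)) hinf hfin
  refine ⟨G, M, hM, hGM', fun z hzM => (hGM z hzM).2, (β.holds_toSentence _).2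
    ⟨⟨x, hx, fun i b hb => ?_, fun z hzx => ?_⟩, fun S hS => ?_, ?_⟩⟩
  · exact (hGx i).symm.subst (motive := fun S => b ∈ S) hb
  · exact ⟨G z, hGL z hzx, fun b hb => hb⟩
  · refine (hGinf S hS).mono ?_
    rintro z ⟨-, rfl⟩ b hb
    exact hb
  · refine hM.subset fun z hz => ?_
    by_contra hzM
    exact hz ⟨G z, (hGM z hzM).1, fun b hb => hb⟩

/-- A model of `∇⁺(T̄, Π, Σ)` can be lifted to a model of `∇⁺(T̄, Π, Σ)^F`, with all points of a
prescribed finite set `X` marked by macro-states only. -/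
theorem BasicForm.exists_holds_finLift {β : BasicForm (A × A)} {U : A × A → Set D}
    (h : Holds U β.toSentence) {X : Set D} (hX : X.Finite) :
    ∃ V : A ⊕ Macro A → Set D, Holds V β.finLift.toSentence ∧
      (∀ Q, ∀ z ∈ V (.inr Q), ∀ e ∈ Q, z ∈ U e) ∧
      ∀ b, ∀ z ∈ V (.inl b), z ∉ X ∧ ∃ a, z ∈ U (a, b) := by
  classical
  obtain ⟨⟨x, hx, hT, hz⟩, hinf, hfin⟩ := (β.holds_toSentence U).1 h
  obtain ⟨G, M, hM, hXM, hxM, hGx, hGL, hGM, hGM', hGinf⟩ := exists_type_assignment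
    (p := fun S z => ∀ b ∈ S, z ∈ U b) (q := fun S z => ∀ b ∈ S, z ∈ U b)
    (L := {S | S ∈ β.Pi ∨ S ∈ β.Sig}) hX (fun _ => Or.inr) hx hT (fun z hzx _ => hz z hzx) hinf hfin
  refine ⟨fun s => match s with
    | .inl b => {z | z ∉ M ∧ b ∈ ran (G z)}
    | .inr Q => {z | z ∈ M ∧ G z = Q}, ?_, ?_, ?_⟩
  · refine holds_finLift.2 ⟨⟨x, hx, fun i => Or.inr ⟨hxM ⟨i, rfl⟩, hGx i⟩, fun z hzx => ?_⟩,
      fun S hS => (hGinf S hS).mono ?_, hM.subset fun z hz => ?_⟩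
    · by_cases hzM : z ∈ M
      · exact Or.inl ⟨G z, hGL z hzx, Or.inr ⟨hzM, rfl⟩⟩
      · exact Or.inr ⟨G z, (hGM z hzM).1, fun b hb => ⟨hzM, hb⟩⟩
    · rintro z ⟨hzM, rfl⟩ b hb
      exact ⟨hzM, hb⟩
    · by_contra hzM
      exact hz ⟨G z, (hGM z hzM).1, fun b hb => ⟨hzM, hb⟩⟩
  · rintro Q z ⟨hzM, rfl⟩
    exact hGM' z hzM
  · rintro b z ⟨hzM, hb⟩
    obtain ⟨a, ha⟩ := mem_ran.1 hb
    exact ⟨fun hzX => hzM (hXM hzX), a, (hGM z hzM).2 _ ha⟩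

end Lifting

namespace ParityAutomaton

section MacroStep

variable {C : Type w} {𝔸 : ParityAutomaton.{v, w} C}
  {Ψ : Macro 𝔸.State → C → List (BasicForm (𝔸.State × 𝔸.State))} {D : Type u}

theorem holds_starConj {U : 𝔸.State × 𝔸.State → Set D} {Q : Macro 𝔸.State} {c : C} :
    Holds U (𝔸.starConj Q c) ↔ ∀ a ∈ ran Q, Holds (fun b => U (a, b)) (𝔸.Δ a c) := by
  simp [starConj, Holds, sat_conj, sat_rename]

theorem holds_finitary_inr {V : 𝔸.State ⊕ Macro 𝔸.State → Set D} {Q : Macro 𝔸.State} {c : C} :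
    Holds V ((𝔸.finitary Ψ).Δ (.inr Q) c) ↔
      (∃ β ∈ Ψ Q c, Holds V β.finLift.toSentence) ∨
        ∀ a ∈ ran Q, Holds (fun b => V (.inl b)) (𝔸.Δ a c) := by
  refine or_congr ?_ ?_
  · refine (holds_basicDisj V _).trans ?_
    simp
  · simp [Holds, sat_conj, sat_rename]

theorem IsBasicChoice.exists_of_holds_finitary (hΨ : IsBasicChoice.{u} 𝔸 Ψ)
    {V : 𝔸.State ⊕ Macro 𝔸.State → Set D} {Q : Macro 𝔸.State} {c : C}
    (h : Holds V ((𝔸.finitary Ψ).Δ (.inr Q) c)) :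
    ∃ (G : D → Macro 𝔸.State) (M : Set D), M.Finite ∧ (∀ z ∈ M, z ∈ V (.inr (G z))) ∧
      (∀ z ∉ M, ∀ b ∈ ran (G z), z ∈ V (.inl b)) ∧
      ∀ a ∈ ran Q, Holds (fun b => {z | (a, b) ∈ G z}) (𝔸.Δ a c) := by
  classical
  rcases holds_finitary_inr.1 h with ⟨β, hβ, h⟩ | h
  · obtain ⟨G, M, hM, hGM, hGM', hG⟩ := BasicForm.exists_of_holds_finLift h
    -- The lifted empty type is empty, so points of `M` of type `∅` carry no macro-state.
    refine ⟨G, {z | z ∈ M ∧ G z ≠ ∅}, hM.subset fun z hz => hz.1,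
      fun z hz => (hGM z hz.1).resolve_left hz.2, fun z hz b hb => ?_,
      holds_starConj.1 ((hΨ Q c D _).1 ((holds_basicDisj _ _).2 ⟨β, hβ, hG⟩))⟩
    refine hGM' z (fun hzM => hz ⟨hzM, fun he => ?_⟩) b hb
    simp [he, ran] at hb
  · have := 𝔸.finite
    have := Fintype.ofFinite 𝔸.State
    refine ⟨fun z => Finset.univ.filter fun e => z ∈ V (.inl e.2), ∅, Set.finite_empty,
      fun z hz => hz.elim, fun z _ b hb => ?_, fun a ha => ?_⟩
    · obtain ⟨a, ha⟩ := mem_ran.1 hb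
      simpa using ha
    · simpa using h a ha

theorem IsBasicChoice.exists_holds_finitary (hΨ : IsBasicChoice.{u} 𝔸 Ψ)
    {U : 𝔸.State → 𝔸.State → Set D} {Q : Macro 𝔸.State} {c : C}
    (h : ∀ a ∈ ran Q, Holds (U a) (𝔸.Δ a c)) {X : Set D} (hX : X.Finite) :
    ∃ V : 𝔸.State ⊕ Macro 𝔸.State → Set D, Holds V ((𝔸.finitary Ψ).Δ (.inr Q) c) ∧
      (∀ Q', ∀ z ∈ V (.inr Q'), ∀ b ∈ ran Q', ∃ a ∈ ran Q, z ∈ U a b) ∧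
      ∀ b, ∀ z ∈ V (.inl b), z ∉ X ∧ ∃ a ∈ ran Q, z ∈ U a b := by
  have hstar : Holds (fun e : 𝔸.State × 𝔸.State => {z | e.1 ∈ ran Q ∧ z ∈ U e.1 e.2})
      (𝔸.starConj Q c) := by
    refine holds_starConj.2 fun a ha => ?_
    simpa [ha] using h a ha
  obtain ⟨β, hβ, hU⟩ := (holds_basicDisj _ _).1 ((hΨ Q c D _).2 hstar)
  obtain ⟨V, hV, hVQ, hVb⟩ := BasicForm.exists_holds_finLift hU hX
  refine ⟨V, holds_finitary_inr.2 (Or.inl ⟨β, hβ, hV⟩), fun Q' z hz b hb => ?_, fun b z hz => ?_⟩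
  · obtain ⟨a, ha⟩ := mem_ran.1 hb
    exact ⟨a, hVQ Q' z hz _ ha⟩
  · obtain ⟨h1, a, h2⟩ := hVb b z hz
    exact ⟨h1, a, h2⟩

end MacroStep

end ParityAutomaton

/-! ### Extracting a finite set from a strategy for the projection -/

/-- The positions `(Q, s)` with a macro-state `Q` that are reached from `(Q₀, r)` when, at `(Q, s)`,
the children `t ∈ M Q s` are marked by the macro-states `G Q s t`. -/
inductive MacroReach {A : Type v} {T : Type u} (G : Macro A → T → T → Macro A)
    (M : Macro A → T → Set T) (Q₀ : Macro A) (r : T) : Macro A → T → Prop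
  | root : MacroReach G M Q₀ r Q₀ r
  | step {Q : Macro A} {s t : T} : MacroReach G M Q₀ r Q s → t ∈ M Q s →
      MacroReach G M Q₀ r (G Q s t) t

/-- Kőnig's lemma: a finitely branching relation without infinite paths has finite cones. -/
theorem finite_descendants {X : Type u} (r : X → X → Prop) (hr : ∀ x, {y | r x y}.Finite)
    (hpath : ∀ f : ℕ → X, ¬ ∀ i, r (f i) (f (i + 1))) (x : X) :
    {y | Relation.ReflTransGen r x y}.Finite := by
  have hwf : WellFounded fun y x => r x y :=
    wellFounded_iff_isEmpty_descending_chain.2 ⟨fun f => hpath f.1 f.2⟩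
  induction x using hwf.induction with
  | _ x ih =>
    refine (((hr x).biUnion ih).insert x).subset fun y hy => ?_
    rcases Relation.ReflTransGen.cases_head hy with rfl | ⟨z, hz, hzy⟩
    · exact Or.inl rfl
    · exact Or.inr (Set.mem_biUnion hz hzy)

namespace ParityAutomaton

variable {P : Type w} {𝔸 : ParityAutomaton.{v, w} (Set (Option P))}
  {Ψ : Macro 𝔸.State → Set (Option P) → List (BasicForm (𝔸.State × 𝔸.State))}

/-- The two disjuncts of the projected transition guess whether the letter `p` is present. -/
theorem holds_finProj_inr {D : Type u} {V : 𝔸.State ⊕ Macro 𝔸.State → Set D}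
    {Q : Macro 𝔸.State} {c : Set P} : Holds V ((𝔸.finProj Ψ).Δ (.inr Q) c) ↔
      ∃ q : Prop, Holds V ((𝔸.finitary Ψ).Δ (.inr Q) (some '' c ∪ {l | l = none ∧ q})) := by
  have hF : (some '' c ∪ {l : Option P | l = none ∧ False}) = some '' c := by simp
  have hT : (some '' c ∪ {l : Option P | l = none ∧ True}) = some '' c ∪ {none} := by
    ext; simp
  constructor
  · rintro (h | h)
    · exact ⟨False, hF.symm ▸ h⟩
    · exact ⟨True, hT.symm ▸ h⟩
  · rintro ⟨q, h⟩
    by_cases hq : q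
    · rw [eq_true hq, hT] at h
      exact Or.inr h
    · rw [eq_false hq, hF] at h
      exact Or.inl h

/-- At a macro-position, the valuation chosen by a strategy for `∃_F p.𝔸` can be thinned out: every
child `t` receives a single type `G t`, read as a macro-state on the finite set `M` and dismantled
into its range elsewhere, and these types satisfy `Δ(a, c)` for all `a ∈ Ran(Q)`. -/
theorem IsStrategy.exists_macroStep (hΨ : IsBasicChoice.{u} 𝔸 Ψ) {𝕋 : Tree.{u, w} (Set P)}
    {F : 𝔸.State ⊕ Macro 𝔸.State → 𝕋.Node → 𝔸.State ⊕ Macro 𝔸.State → Set 𝕋.Node}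
    {I : 𝔸.State ⊕ Macro 𝔸.State → 𝕋.Node → Prop} (hF : (𝔸.finProj Ψ).IsStrategy 𝕋.toLTS F I)
    {Q : Macro 𝔸.State} {s : 𝕋.Node} (hI : I (.inr Q) s) :
    ∃ (q : Prop) (G : 𝕋.Node → Macro 𝔸.State) (M : Set 𝕋.Node), M.Finite ∧
      (∀ t ∈ M, t ∈ F (.inr Q) s (.inr (G t))) ∧
      (∀ t ∉ M, 𝕋.R s t → ∀ b ∈ ran (G t), t ∈ F (.inr Q) s (.inl b)) ∧
      ∀ a ∈ ran Q, Holds (D := {t : 𝕋.Node // 𝕋.R s t}) (fun b => {t | (a, b) ∈ G t.1})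
        (𝔸.Δ a (some '' 𝕋.label s ∪ {l | l = none ∧ q})) := by
  classical
  obtain ⟨q, hq⟩ := holds_finProj_inr.1 (hF.holds hI)
  obtain ⟨G, M, hM, h1, h2, h3⟩ := hΨ.exists_of_holds_finitary hq
  let G' : 𝕋.Node → Macro 𝔸.State := fun t => if h : 𝕋.R s t then G ⟨t, h⟩ else ∅
  have hG : ∀ t : {t : 𝕋.Node // 𝕋.R s t}, G' t.1 = G t := fun t => dif_pos t.2
  refine ⟨q, G', Subtype.val '' M, hM.image _, ?_, fun t ht hst b hb => ?_, fun a ha => ?_⟩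
  · rintro _ ⟨t, ht, rfl⟩
    rw [hG]
    exact h1 t ht
  · rw [hG ⟨t, hst⟩] at hb
    exact h2 ⟨t, hst⟩ (fun h => ht ⟨_, h, rfl⟩) b hb
  · simp only [hG]
    exact h3 a ha

/-- After thinning out a winning strategy for `∃_F p.𝔸`, every node carries at most one reachable
macro-state. The nodes that carry one form a finitely branching subtree without infinite branches,
because macro-states have the odd priority `1`; so it is finite, and `S` consists of those of its
nodes at which `p` is guessed to be present. For `𝔸`, `∃` plays the types of the subtree on it, and
the given strategy off it; as no play re-enters the subtree, this is a positional strategy. -/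
theorem exists_finite_variant_accepts (hΨ : IsBasicChoice.{u} 𝔸 Ψ) {𝕋 : Tree.{u, w} (Set P)}
    (h : (𝔸.finProj Ψ).Accepts 𝕋.toLTS) :
    ∃ S : Set 𝕋.Node, S.Finite ∧ 𝔸.Accepts (𝕋.variant S).toLTS := by
  classical
  obtain ⟨F, I, hF, h0⟩ : ∃ (F : 𝔸.State ⊕ Macro 𝔸.State → 𝕋.Node →
    𝔸.State ⊕ Macro 𝔸.State → Set 𝕋.Node) (I : 𝔸.State ⊕ Macro 𝔸.State → 𝕋.Node → Prop),
    (𝔸.finProj Ψ).IsStrategy 𝕋.toLTS F I ∧ I (.inr {(𝔸.init, 𝔸.init)}) 𝕋.root :=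
    h.exists_isStrategy
  have hstep : ∀ Q s, ∃ (q : Prop) (G : 𝕋.Node → Macro 𝔸.State) (M : Set 𝕋.Node),
      I (.inr Q) s → M.Finite ∧ (∀ t ∈ M, t ∈ F (.inr Q) s (.inr (G t))) ∧
      (∀ t ∉ M, 𝕋.R s t → ∀ b ∈ ran (G t), t ∈ F (.inr Q) s (.inl b)) ∧
      ∀ a ∈ ran Q, Holds (D := {t : 𝕋.Node // 𝕋.R s t}) (fun b => {t | (a, b) ∈ G t.1})
        (𝔸.Δ a (some '' 𝕋.label s ∪ {l | l = none ∧ q})) := by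
    intro Q s
    by_cases hI : I (.inr Q) s
    · obtain ⟨q, G, M, h⟩ := hF.exists_macroStep hΨ hI
      exact ⟨q, G, M, fun _ => h⟩
    · exact ⟨False, fun _ => ∅, ∅, fun h => (hI h).elim⟩
  choose q G M hGM using hstep
  set MR := MacroReach G M {(𝔸.init, 𝔸.init)} 𝕋.root
  have hMI : ∀ {Q s}, MR Q s → I (.inr Q) s := by
    intro Q s h
    induction h with
    | root => exact h0
    | step _ ht ih => exact hF.closed ih ((hGM _ _ ih).2.1 _ ht)
  have hR : ∀ {Q s t}, MR Q s → t ∈ M Q s → 𝕋.R s t := fun h ht =>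
    hF.subset (hMI h) ((hGM _ _ (hMI h)).2.1 _ ht)
  have huniq : ∀ {Q s}, MR Q s → ∀ {Q'}, MR Q' s → Q = Q' := by
    intro Q s h
    induction h with
    | root =>
      intro Q' h'
      generalize hr : 𝕋.root = r at h'
      cases h' with
      | root => rfl
      | step h' ht => exact (𝕋.root_no_pred _ (hr ▸ hR h' ht)).elim
    | @step Q s t h ht ih =>
      intro Q' h'
      cases h' with
      | root => exact (𝕋.root_no_pred _ (hR h ht)).elim
      | @step Q' s' _ h' ht' =>
        obtain rfl := 𝕋.parent_unique (hR h ht) (hR h' ht')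
        rw [ih h']
  have hchild : ∀ {Q s t}, MR Q s → 𝕋.R s t → (∃ Q', MR Q' t) → t ∈ M Q s := by
    rintro Q s t h hst ⟨Q', h'⟩
    cases h' with
    | root => exact (𝕋.root_no_pred _ hst).elim
    | @step Q' s' _ h' ht' =>
      obtain rfl := 𝕋.parent_unique hst (hR h' ht')
      rwa [huniq h h']
  have hparent : ∀ {s t}, 𝕋.R s t → (∃ Q', MR Q' t) → ∃ Q, MR Q s := by
    rintro s t hst ⟨Q', h'⟩
    cases h' with
    | root => exact (𝕋.root_no_pred _ hst).elim
    | @step Q' s' _ h' ht' =>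
      obtain rfl := 𝕋.parent_unique hst (hR h' ht')
      exact ⟨_, h'⟩
  -- The least priority along a sequence of macro-states is `1`.
  have hodd : ∀ (Q : ℕ → Macro 𝔸.State) (s : ℕ → 𝕋.Node), (∀ i, I (.inr (Q i)) (s i)) →
      ¬ ∀ i, s (i + 1) ∈ F (.inr (Q i)) (s i) (.inr (Q (i + 1))) := by
    intro Q s hI hs
    obtain ⟨n, hn, hf, -⟩ := hF.wins (fun i => .inr (Q i)) s hI hs
    obtain ⟨i, hi⟩ := hf.exists
    have hi : 1 = n := hi
    subst hi
    exact Nat.not_even_one hn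
  have hfin : {s | ∃ Q, MR Q s}.Finite := by
    let r : Macro 𝔸.State × 𝕋.Node → Macro 𝔸.State × 𝕋.Node → Prop := fun x y =>
      MR x.1 x.2 ∧ y.2 ∈ M x.1 x.2 ∧ y.1 = G x.1 x.2 y.2
    have h1 := finite_descendants r (fun x => ?_) (fun f hf => ?_)
      ({(𝔸.init, 𝔸.init)}, 𝕋.root)
    · refine (h1.image Prod.snd).subset ?_
      rintro s ⟨Q, h⟩
      refine ⟨(Q, s), ?_, rfl⟩
      change Relation.ReflTransGen r _ _
      induction h with
      | root => exact .refl
      | step h ht ih => exact ih.tail ⟨h, ht, rfl⟩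
    · by_cases hx : MR x.1 x.2
      · refine ((hGM _ _ (hMI hx)).1.image fun t => (G x.1 x.2 t, t)).subset ?_
        rintro ⟨Q, t⟩ ⟨-, ht, hQ⟩
        exact ⟨t, ht, Prod.ext hQ.symm rfl⟩
      · exact Set.finite_empty.subset fun y hy => hx hy.1
    · refine hodd (fun i => (f i).1) (fun i => (f i).2) (fun i => hMI (hf i).1) fun i => ?_
      have := (hGM _ _ (hMI (hf i).1)).2.1 _ (hf i).2.1
      rwa [← (hf i).2.2] at this
  set S : Set 𝕋.Node := {s | ∃ Q, MR Q s ∧ q Q s}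
  refine ⟨S, hfin.subset fun s ⟨Q, h, _⟩ => ⟨Q, h⟩, ?_⟩
  -- The macro-state at a node is unique, so the choice of `Q` below does not depend on the play.
  let F' : 𝔸.State → 𝕋.Node → 𝔸.State → Set 𝕋.Node := fun a s b =>
    if h : ∃ Q, MR Q s then {t | 𝕋.R s t ∧ (a, b) ∈ G h.choose s t} else F (.inl a) s (.inl b)
  have hF'1 : ∀ {Q a s b}, MR Q s → F' a s b = {t | 𝕋.R s t ∧ (a, b) ∈ G Q s t} := by
    intro Q a s b h
    have hex : ∃ Q, MR Q s := ⟨Q, h⟩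
    simp only [F', dif_pos hex]
    rw [huniq hex.choose_spec h]
  have hF'2 : ∀ {a s b}, (¬ ∃ Q, MR Q s) → F' a s b = F (.inl a) s (.inl b) :=
    fun h => dif_neg h
  let I' : 𝔸.State → 𝕋.Node → Prop := fun a s =>
    (∃ Q, MR Q s ∧ a ∈ ran Q) ∨ (¬ ∃ Q, MR Q s) ∧ I (.inl a) s
  have hlabel : ∀ s, (𝕋.variant S).label s = some '' 𝕋.label s ∪ {l | l = none ∧ s ∈ S} :=
    fun s => rfl
  refine IsStrategy.accepts (𝕋 := (𝕋.variant S).toLTS) (F := F') (I := I')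
    ⟨?_, ?_, ?_, ?_⟩ ?_
  · rintro a s (⟨Q, h, ha⟩ | ⟨hno, h⟩) b t ht
    · rw [hF'1 h] at ht
      exact ht.1
    · rw [hF'2 hno] at ht
      exact hF.subset h ht
  · rintro a s (⟨Q, h, ha⟩ | ⟨hno, h⟩)
    · have hsS : (s ∈ S) = q Q s := propext
        ⟨fun ⟨Q', h', hq⟩ => huniq h' h ▸ hq, fun hq => ⟨Q, h, hq⟩⟩
      rw [hlabel, hsS]
      have := (hGM _ _ (hMI h)).2.2.2 a ha
      have heq : (fun b => {t : {t : 𝕋.Node // 𝕋.R s t} | t.1 ∈ F' a s b}) =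
          fun b => {t | (a, b) ∈ G Q s t.1} := by
        funext b
        ext t
        rw [Set.mem_ofPred_eq, hF'1 h]
        exact ⟨fun h => h.2, fun h => ⟨t.2, h⟩⟩
      rw [← heq] at this
      exact this
    · have hsS : s ∉ S := fun ⟨Q, h, _⟩ => hno ⟨Q, h⟩
      have hl : (𝕋.variant S).label s = some '' 𝕋.label s := by
        rw [hlabel]
        simp [hsS]
      rw [hl]
      have := (sat_rename _ _ _ _).1 (hF.holds h)
      simp only [hF'2 hno]
      exact this
  · rintro a s (⟨Q, h, ha⟩ | ⟨hno, h⟩) b t ht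
    · rw [hF'1 h] at ht
      have hb : b ∈ ran (G Q s t) := mem_ran.2 ⟨a, ht.2⟩
      by_cases htM : t ∈ M Q s
      · exact Or.inl ⟨_, .step h htM, hb⟩
      · exact Or.inr ⟨fun hex => htM (hchild h ht.1 hex),
          hF.closed (hMI h) ((hGM _ _ (hMI h)).2.2.1 t htM ht.1 b hb)⟩
    · rw [hF'2 hno] at ht
      exact Or.inr ⟨fun hex => hno (hparent (hF.subset h ht) hex), hF.closed h ht⟩
  · intro α σ hI hσ
    have hRσ : ∀ i, 𝕋.R (σ i) (σ (i + 1)) := fun i => by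
      have ht := hσ i
      rcases hI i with ⟨Q, h, ha⟩ | ⟨hno, h⟩
      · rw [hF'1 h] at ht
        exact ht.1
      · rw [hF'2 hno] at ht
        exact hF.subset h ht
    by_cases hall : ∀ i, ∃ Q, MR Q (σ i)
    · exact (Set.infinite_range_of_injective (𝕋.injective_of_path hRσ)
        (hfin.subset (by rintro _ ⟨i, rfl⟩; exact hall i))).elim
    · push Not at hall
      obtain ⟨k, hk⟩ := hall
      have hno : ∀ i, ¬ ∃ Q, MR Q (σ (i + k)) := by
        intro i
        induction i with
        | zero => simpa using hk
        | succ i ih =>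
          rw [show i + 1 + k = i + k + 1 by ring]
          exact fun hex => ih (hparent (hRσ _) hex)
      refine (leastEven_add_iff _ k).1 (hF.wins (fun i => .inl (α (i + k)))
        (fun i => σ (i + k)) (fun i => ?_) fun i => ?_)
      · rcases hI (i + k) with ⟨Q, h, -⟩ | ⟨-, h⟩
        exacts [(hno i ⟨Q, h⟩).elim, h]
      · have := hσ (i + k)
        rw [hF'2 (hno i)] at this
        rwa [show i + 1 + k = i + k + 1 by ring]
  · exact Or.inl ⟨_, .root, mem_ran.2 ⟨𝔸.init, by simp⟩⟩

/-! ### A strategy for the projection from a finite set -/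

/-- Let `N` be the finite set of ancestors of nodes in `S`. In `∃_F p.𝔸`, `∃` bundles her strategy
for `𝔸` into macro-states as long as the match stays in `N`, marking every child in `N` by a
macro-state, and dismantles the macro-state at the first node outside `N`; below that node `p` does
not occur, so that the states of `𝔸` can read the unlabelled tree. -/
theorem finProj_accepts_of_variant (hΨ : IsBasicChoice.{u} 𝔸 Ψ) {𝕋 : Tree.{u, w} (Set P)}
    {S : Set 𝕋.Node} (hS : S.Finite) (h : 𝔸.Accepts (𝕋.variant S).toLTS) :
    (𝔸.finProj Ψ).Accepts 𝕋.toLTS := by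
  classical
  obtain ⟨F, I, hF, h0⟩ : ∃ (F : 𝔸.State → 𝕋.Node → 𝔸.State → Set 𝕋.Node)
    (I : 𝔸.State → 𝕋.Node → Prop),
    𝔸.IsStrategy (𝕋.variant S).toLTS F I ∧ I 𝔸.init 𝕋.root := h.exists_isStrategy
  have hsub : ∀ {a s}, I a s → ∀ {b t}, t ∈ F a s b → 𝕋.R s t := hF.subset
  have hholds : ∀ {a s}, I a s → Holds (D := {t : 𝕋.Node // 𝕋.R s t})
      (fun b => {t | t.1 ∈ F a s b}) (𝔸.Δ a (some '' 𝕋.label s ∪ {l | l = none ∧ s ∈ S})) :=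
    hF.holds
  set N : Set 𝕋.Node := ⋃ s ∈ S, {t | Relation.ReflTransGen 𝕋.R t s}
  have hNfin : N.Finite := hS.biUnion fun s _ => 𝕋.finite_ancestors s
  have hSN : S ⊆ N := fun s hs => Set.mem_biUnion hs .refl
  have hNparent : ∀ {s t}, 𝕋.R s t → t ∈ N → s ∈ N := by
    intro s t hst ht
    obtain ⟨r, hr, htr⟩ := Set.mem_iUnion₂.1 ht
    exact Set.mem_biUnion hr (.head hst htr)
  have hstep : ∀ Q s, ∃ V : 𝔸.State ⊕ Macro 𝔸.State → Set 𝕋.Node, (∀ a ∈ ran Q, I a s) →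
      (∀ b, ∀ t ∈ V b, 𝕋.R s t) ∧
      Holds (D := {t : 𝕋.Node // 𝕋.R s t}) (fun b => {t | t.1 ∈ V b})
        ((𝔸.finProj Ψ).Δ (.inr Q) (𝕋.label s)) ∧
      (∀ Q', ∀ t ∈ V (.inr Q'), s ∈ N ∧ ∀ b ∈ ran Q', I b t) ∧
      ∀ b, ∀ t ∈ V (.inl b), t ∉ N ∧ I b t := by
    intro Q s
    by_cases hI : ∀ a ∈ ran Q, I a s
    swap
    · exact ⟨fun _ => ∅, fun h => (hI h).elim⟩
    -- On `N` a basic form of `Ψ` is lifted; off `N` the disjunct `⋀_{a ∈ Ran(Q)} Δ(a, c)` is used.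
    by_cases hs : s ∈ N
    · obtain ⟨V, hV, hVQ, hVb⟩ := hΨ.exists_holds_finitary (Q := Q)
        (U := fun a b => {t : {t : 𝕋.Node // 𝕋.R s t} | t.1 ∈ F a s b})
        (fun a ha => hholds (hI a ha)) (X := {t | t.1 ∈ N})
        (hNfin.preimage Subtype.val_injective.injOn)
      refine ⟨fun b => Subtype.val '' V b, fun _ => ⟨?_, ?_, ?_, ?_⟩⟩
      · rintro b _ ⟨t, -, rfl⟩
        exact t.2
      · refine holds_finProj_inr.2 ⟨s ∈ S, ?_⟩
        have hval : (fun b => {t : {t : 𝕋.Node // 𝕋.R s t} | t.1 ∈ Subtype.val '' V b}) = V :=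
          funext fun b => Set.preimage_image_eq _ Subtype.val_injective
        exact hval.symm ▸ hV
      · rintro Q' _ ⟨t, ht, rfl⟩
        refine ⟨hs, fun b hb => ?_⟩
        obtain ⟨a, ha, hta⟩ := hVQ Q' t ht b hb
        exact hF.closed (hI a ha) hta
      · rintro b _ ⟨t, ht, rfl⟩
        obtain ⟨htN, a, ha, hta⟩ := hVb b t ht
        exact ⟨htN, hF.closed (hI a ha) hta⟩
    · refine ⟨fun
        | .inl b => {t | ∃ a ∈ ran Q, t ∈ F a s b}
        | .inr _ => ∅, fun _ => ⟨?_, ?_, ?_, ?_⟩⟩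
      · rintro (b | Q') t ht
        · obtain ⟨a, ha, hta⟩ := ht
          exact hsub (hI a ha) hta
        · exact ht.elim
      · refine holds_finProj_inr.2 ⟨s ∈ S, holds_finitary_inr.2 (Or.inr fun a ha => ?_)⟩
        exact (𝔸.positive a _).holds_mono (fun b t ht => ⟨a, ha, ht⟩) (hholds (hI a ha))
      · exact fun Q' t ht => ht.elim
      · rintro b t ⟨a, ha, hta⟩
        exact ⟨fun htN => hs (hNparent (hsub (hI a ha) hta) htN), hF.closed (hI a ha) hta⟩
  choose V hV using hstep
  let F' : 𝔸.State ⊕ Macro 𝔸.State → 𝕋.Node → 𝔸.State ⊕ Macro 𝔸.State → Set 𝕋.Node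
    | .inl a, s, .inl b => F a s b
    | .inl _, _, .inr _ => ∅
    | .inr Q, s, b => V Q s b
  let I' : 𝔸.State ⊕ Macro 𝔸.State → 𝕋.Node → Prop
    | .inl a, s => s ∉ N ∧ I a s
    | .inr Q, s => ∀ a ∈ ran Q, I a s
  have hclosed : ∀ {a s}, I' a s → ∀ {b t}, t ∈ F' a s b → I' b t := by
    rintro (a | Q) s hI (b | Q') t ht
    · exact ⟨fun htN => hI.1 (hNparent (hsub hI.2 ht) htN), hF.closed hI.2 ht⟩
    · exact ht.elim
    · exact (hV Q s hI).2.2.2 b t ht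
    · exact ((hV Q s hI).2.2.1 Q' t ht).2
  have hsub' : ∀ {a s}, I' a s → ∀ {b t}, t ∈ F' a s b → 𝕋.R s t := by
    rintro (a | Q) s hI b t ht
    · rcases b with b | Q'
      exacts [hsub hI.2 ht, ht.elim]
    · exact (hV Q s hI).1 b t ht
  refine IsStrategy.accepts (𝕋 := 𝕋.toLTS) (𝔸 := 𝔸.finProj Ψ) (F := F') (I := I')
    ⟨hsub', ?_, hclosed, ?_⟩ ?_
  · rintro (a | Q) s hI
    · refine (sat_rename _ _ _ _).2 ?_
      have := hholds hI.2
      have hsS : s ∉ S := fun hs => hI.1 (hSN hs)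
      have hl : some '' 𝕋.label s ∪ {l : Option P | l = none ∧ s ∈ S} = some '' 𝕋.label s := by
        simp [hsS]
      rw [hl] at this
      exact this
    · exact (hV Q s hI).2.1
  · intro α σ hI hσ
    -- Once a match leaves the macro-states it never returns, and its tail is a match of `𝔸`.
    by_cases hall : ∃ k a, α k = .inl a
    · obtain ⟨k, hk⟩ := hall
      have hinl : ∀ i, ∃ a, α (i + k) = .inl a := by
        intro i
        induction i with
        | zero => simpa using hk
        | succ i ih =>
          obtain ⟨a, ha⟩ := ih
          rw [show i + 1 + k = i + k + 1 by ring]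
          have := hσ (i + k)
          rw [ha] at this
          rcases hb : α (i + k + 1) with b | Q
          · exact ⟨b, rfl⟩
          · rw [hb] at this
            exact this.elim
      choose β hβ using hinl
      refine (leastEven_add_iff _ k).1 ?_
      simp only [hβ]
      refine hF.wins β (fun i => σ (i + k)) (fun i => ?_) fun i => ?_
      · have := hI (i + k)
        rw [hβ] at this
        exact this.2
      · have := hσ (i + k)
        rw [show i + k + 1 = i + 1 + k by ring, hβ, hβ] at this
        exact this
    · have hinr : ∀ i, ∃ Q, α i = .inr Q := by
        intro i
        rcases h : α i with a | Q
        exacts [(hall ⟨i, a, h⟩).elim, ⟨Q, rfl⟩]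
      choose Q hQ using hinr
      refine (Set.infinite_range_of_injective (𝕋.injective_of_path fun i => hsub' (hI i) (hσ i))
        (hNfin.subset ?_)).elim
      -- A match that never leaves the macro-states would stay in the finite set `N`.
      rintro _ ⟨i, rfl⟩
      have hi := hI i
      have := hσ i
      rw [hQ] at hi
      rw [hQ, hQ] at this
      exact ((hV _ _ hi).2.2.1 _ _ this).1
  · intro a ha
    obtain ⟨b, hb⟩ := mem_ran.1 ha
    obtain rfl : a = 𝔸.init := (Prod.ext_iff.1 (Finset.mem_singleton.1 hb)).2
    exact h0

end ParityAutomaton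

end WMSO

theorem mainTheorem9 {P : Type w}
    (𝔸 : WMSO.ParityAutomaton.{v, w} (Set (Option P))) (h𝔸 : 𝔸.IsWMSO) :
    (∃ Ψ, WMSO.ParityAutomaton.IsBasicChoice.{u} 𝔸 Ψ) ∧
      ∀ Ψ, WMSO.ParityAutomaton.IsBasicChoice.{u} 𝔸 Ψ →
        (𝔸.finProj Ψ).language =
          WMSO.TreeLanguage.finProj (WMSO.ParityAutomaton.language.{u} 𝔸) := by
  refine ⟨𝔸.exists_isBasicChoice, fun Ψ hΨ => Set.ext fun 𝕋 => ⟨fun h => ?_, ?_⟩⟩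
  · exact WMSO.ParityAutomaton.exists_finite_variant_accepts hΨ h
  · rintro ⟨S, hS, h⟩
    exact WMSO.ParityAutomaton.finProj_accepts_of_variant hΨ hS h
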